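/- **The L-packing problem.** An instance consists of integers $N\ge 1$ and $0\le w_L,h_L\le N$, a finite family of horizontal items and a finite family of vertical items, $n$ items in total. Item $i$ is an axis-parallel rectangle (not to be rotated) of positive integer width $w(i)$ and height $h(i)$ with an integer profit $p(i)\ge 0$; horizontal items have $w(i)>N/2$ and vertical items have $h(i)>N/2$. A *packing* selects a set $S$ of items and gives to each $i\in S$ a left-bottom corner $(x_i,y_i)\in\mathbb N^2$ so that every selected horizontal item lies in the horizontal box $[0,N]\times[0,h_L]$, every selected vertical item lies in the vertical box $[0,w_L]\times[0,N]$, and the interiors of the selected items are pairwise disjoint; its profit is $\sum_{i\in S}p(i)$. It is an *L-packing* if moreover the horizontal items are at the bottom-right and the vertical items at the top-left of the L-shaped region $([0,N]\times[0,h_L])\cup([0,w_L]\times[0,N])$, that is, for all selected horizontal $i$ and vertical $j$, either $j$ is to the left of $i$ ($x_j+w(j)\le x_i$) or $j$ is above $i$ ($y_i+h(i)\le y_j$). **Theorem.** There is a PTAS for the L-packing problem: there is an algorithm $\mathcal A$ (one program of a random access machine) that takes as input a rational $\varepsilon>0$ and an instance $I$, such that for every fixed $\varepsilon$ there is a constant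 $c=c_\varepsilon$ such that on every instance $I$ the algorithm halts after at most $c\,(n+1)^{c}$ steps, that is, in time $n^{O_\varepsilon(1)}$, and outputs an L-packing of profit $\mathrm{apx}$ such that every L-packing of $I$ has profit at most $(1+\varepsilon)\,\mathrm{apx}$. If moreover $w_L,h_L\le N/2$, then every packing of $I$ has profit at most $(1+\varepsilon)\,\mathrm{apx}$. Here the random access machine has finitely many registers and finitely many random-access arrays holding natural numbers. One step is an assignment of a constant, a copy, an addition, a truncated subtraction, a read or write of an array cell addressed by a register, or a comparison of two registers that controls a branch or a loop. There is no multiplication, so a step lengthens the numbers by at most one bit and the running time is also polynomial, for fixed $\varepsilon$, on a Turing machine in the bit length of the input. -/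

import Mathlib

namespace LPack

/-! ### The machine model: a random access machine with unit-cost additive instructions -/

/-- A machine state: registers `reg r`, and random-access arrays with cells `arr a k`,
all holding natural numbers of arbitrary size. A program names finitely many registers and
finitely many arrays; the cells of an array are addressed by the contents of registers. -/
structure State where
  reg : ℕ → ℕ
  arr : ℕ → ℕ → ℕ

/-- Assign the value `v` to register `r`. -/
def State.setReg (s : State) (r v : ℕ) : State :=
  { s with reg := Function.update s.reg r v }

/-- Assign the value `v` to cell `k` of array `a`. -/
def State.setArr (s : State) (a k v : ℕ) : State :=
  { s with arr := Function.update s.arr a (Function.update (s.arr a) k v) }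

/-- Programs of the random access machine. The only arithmetic is addition and (truncated)
subtraction; there is no multiplication, so that one step lengthens the largest number stored in
the machine by at most one bit, and the number of steps is polynomially related to the running
time of a multi-tape Turing machine. -/
inductive Prog : Type
  /-- Do nothing. -/
  | skip : Prog
  /-- `const d n`: register `d` receives the fixed number `n`. -/
  | const (d n : ℕ) : Prog
  /-- `copy d a`: register `d` receives the content of register `a`. -/
  | copy (d a : ℕ) : Prog
  /-- `add d a b`: register `d` receives the sum of the registers `a` and `b`. -/
  | add (d a b : ℕ) : Prog
  /-- `sub d a b`: register `d` receives the truncated difference of the registers `a`, `b`. -/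
  | sub (d a b : ℕ) : Prog
  /-- `load d m a`: register `d` receives the cell of array `m` addressed by register `a`. -/
  | load (d m a : ℕ) : Prog
  /-- `store m a b`: the cell of array `m` addressed by register `a` receives register `b`. -/
  | store (m a b : ℕ) : Prog
  /-- Sequential composition. -/
  | seq (P Q : Prog) : Prog
  /-- `cond a b P Q`: run `P` if register `a` is smaller than register `b`, else run `Q`. -/
  | cond (a b : ℕ) (P Q : Prog) : Prog
  /-- `loop a b P`: while register `a` is smaller than register `b`, run `P`. -/
  | loop (a b : ℕ) (P : Prog) : Prog

/-- `Exec P s t s'`: started in state `s`, the program `P` halts after exactly `t` steps in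
state `s'`. Every elementary instruction and every test of a condition counts as one step. -/
inductive Exec : Prog → State → ℕ → State → Prop
  | skip (s : State) : Exec Prog.skip s 1 s
  | const (d n : ℕ) (s : State) : Exec (Prog.const d n) s 1 (s.setReg d n)
  | copy (d a : ℕ) (s : State) : Exec (Prog.copy d a) s 1 (s.setReg d (s.reg a))
  | add (d a b : ℕ) (s : State) : Exec (Prog.add d a b) s 1 (s.setReg d (s.reg a + s.reg b))
  | sub (d a b : ℕ) (s : State) : Exec (Prog.sub d a b) s 1 (s.setReg d (s.reg a - s.reg b))
  | load (d m a : ℕ) (s : State) : Exec (Prog.load d m a) s 1 (s.setReg d (s.arr m (s.reg a)))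
  | store (m a b : ℕ) (s : State) :
      Exec (Prog.store m a b) s 1 (s.setArr m (s.reg a) (s.reg b))
  | seq {P Q : Prog} {s s' s'' : State} {t t' : ℕ} :
      Exec P s t s' → Exec Q s' t' s'' → Exec (Prog.seq P Q) s (t + t') s''
  | cond_true {a b : ℕ} {P Q : Prog} {s s' : State} {t : ℕ} :
      s.reg a < s.reg b → Exec P s t s' → Exec (Prog.cond a b P Q) s (t + 1) s'
  | cond_false {a b : ℕ} {P Q : Prog} {s s' : State} {t : ℕ} :
      ¬ s.reg a < s.reg b → Exec Q s t s' → Exec (Prog.cond a b P Q) s (t + 1) s'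
  | loop_true {a b : ℕ} {P : Prog} {s s' s'' : State} {t t' : ℕ} :
      s.reg a < s.reg b → Exec P s t s' → Exec (Prog.loop a b P) s' t' s'' →
      Exec (Prog.loop a b P) s (t + t' + 1) s''
  | loop_false {a b : ℕ} {P : Prog} {s : State} :
      ¬ s.reg a < s.reg b → Exec (Prog.loop a b P) s 1 s

/-! ### The L-packing problem -/

/-- An item: an axis-parallel rectangle (not to be rotated) with a profit. -/
structure Item where
  width : ℕ
  height : ℕ
  profit : ℕ

/-- An instance of the L-packing problem: the side `N` of the knapsack, the width `wL` of the
vertical box `[0, wL] × [0, N]` and the height `hL` of the horizontal box `[0, N] × [0, hL]`, whose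
union is the L-shaped region; horizontal items, of width larger than `N / 2`; vertical items, of
height larger than `N / 2`. -/
structure Instance where
  N : ℕ
  wL : ℕ
  hL : ℕ
  numHor : ℕ
  numVer : ℕ
  hor : Fin numHor → Item
  ver : Fin numVer → Item
  N_pos : 0 < N
  wL_le : wL ≤ N
  hL_le : hL ≤ N
  hor_width : ∀ i, N < 2 * (hor i).width
  hor_height : ∀ i, 0 < (hor i).height
  ver_width : ∀ j, 0 < (ver j).width
  ver_height : ∀ j, N < 2 * (ver j).height

namespace Instance

/-- The items of an instance: the horizontal ones (`Sum.inl`) and the vertical ones (`Sum.inr`). -/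
abbrev Idx (I : Instance) : Type := Fin I.numHor ⊕ Fin I.numVer

/-- The item with a given index. -/
def item (I : Instance) : I.Idx → Item := Sum.elim I.hor I.ver

/-- The number `n` of items. -/
def numItems (I : Instance) : ℕ := I.numHor + I.numVer

/-- A candidate solution: a set of chosen items, and the position `(x i, y i)` of the left-bottom
corner of every chosen item `i`. -/
structure Placement (I : Instance) where
  chosen : Finset I.Idx
  x : I.Idx → ℕ
  y : I.Idx → ℕ

variable {I : Instance}

/-- Right coordinate of an item. -/
def Placement.right (P : I.Placement) (i : I.Idx) : ℕ := P.x i + (I.item i).width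

/-- Top coordinate of an item. -/
def Placement.top (P : I.Placement) (i : I.Idx) : ℕ := P.y i + (I.item i).height

/-- The total profit of the chosen items. -/
def Placement.profit (P : I.Placement) : ℕ := ∑ i ∈ P.chosen, (I.item i).profit

/-- The chosen horizontal items lie in the horizontal box, the chosen vertical items lie in the
vertical box, and the interiors of any two distinct chosen items are disjoint. -/
structure Placement.IsPacking (P : I.Placement) : Prop where
  hor_box : ∀ i : Fin I.numHor, Sum.inl i ∈ P.chosen →
    P.right (Sum.inl i) ≤ I.N ∧ P.top (Sum.inl i) ≤ I.hL
  ver_box : ∀ j : Fin I.numVer, Sum.inr j ∈ P.chosen →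
    P.right (Sum.inr j) ≤ I.wL ∧ P.top (Sum.inr j) ≤ I.N
  disjoint : ∀ i ∈ P.chosen, ∀ j ∈ P.chosen, i ≠ j →
    P.right i ≤ P.x j ∨ P.right j ≤ P.x i ∨ P.top i ≤ P.y j ∨ P.top j ≤ P.y i

/-- An L-packing: a packing in which the horizontal items are at the bottom-right of the region and
the vertical items at the top-left, that is, each chosen vertical item is to the left of or above
each chosen horizontal item. -/
structure Placement.IsLPacking (P : I.Placement) : Prop extends P.IsPacking where
  left_or_above : ∀ (i : Fin I.numHor) (j : Fin I.numVer),
    Sum.inl i ∈ P.chosen → Sum.inr j ∈ P.chosen →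
      P.right (Sum.inr j) ≤ P.x (Sum.inl i) ∨ P.top (Sum.inl i) ≤ P.y (Sum.inr j)

/-- Contents of an array that holds the finite sequence `f` and is zero beyond it. -/
def arrayOf {n : ℕ} (f : Fin n → ℕ) (k : ℕ) : ℕ := if h : k < n then f ⟨k, h⟩ else 0

/-- The initial state of the machine on the input consisting of the accuracy `ε` (numerator and
denominator) and the instance `I`. Registers `0` to `6` hold the numbers of the input, arrays `0`
to `5` the widths, heights and profits of the items; everything else is zero. -/
def input (I : Instance) (ε : ℚ) : State where
  reg r := match r with
    | 0 => ε.num.toNat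
    | 1 => ε.den
    | 2 => I.N
    | 3 => I.wL
    | 4 => I.hL
    | 5 => I.numHor
    | 6 => I.numVer
    | _ => 0
  arr a := match a with
    | 0 => arrayOf fun i => (I.hor i).width
    | 1 => arrayOf fun i => (I.hor i).height
    | 2 => arrayOf fun i => (I.hor i).profit
    | 3 => arrayOf fun j => (I.ver j).width
    | 4 => arrayOf fun j => (I.ver j).height
    | 5 => arrayOf fun j => (I.ver j).profit
    | _ => fun _ => 0

/-- The solution that the machine has written when it halts in state `s`: arrays `6`, `7`, `8` hold
the choice (nonzero for a chosen item), the `x`- and the `y`-coordinates for the horizontal items,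
and arrays `9`, `10`, `11` the same for the vertical items. -/
def output (I : Instance) (s : State) : I.Placement where
  chosen := Finset.univ.filter fun i : I.Idx =>
    Sum.elim (fun i : Fin I.numHor => s.arr 6 i) (fun j : Fin I.numVer => s.arr 9 j) i ≠ 0
  x := Sum.elim (fun i => s.arr 7 i) (fun j => s.arr 10 j)
  y := Sum.elim (fun i => s.arr 8 i) (fun j => s.arr 11 j)

end Instance

end LPack

/-!
The scheme computes a longest path in a graph of polynomial size.

*Sorted packings.* Horizontal items are wider than half of the knapsack, so chosen ones lie above
each other, and likewise chosen vertical items lie side by side. List the chosen horizontal items by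
decreasing width and the vertical ones by decreasing height. If the items up to the horizontal item
`i` have total height `S i` and those up to the vertical item `j` total width `S' j`, then in an
L-packing `S i + h j ≤ N` or `S' j + w i ≤ N` for every pair: otherwise some item at least as wide
as `i` would reach above `N - h j`, some item at least as high as `j` would reach to the right of
`N - w i`, and these two would collide. So the two lists can be merged into one sequence in which
each item is pushed to the far end of its arm, next to the previous item of its kind, and fits
because it avoids the whole extent of the other kind (`exists_chain`). A partial packing is described
by the last item of each kind and by the two total thicknesses; this is a *record*, and appending an
item is an `Edge` of the graph. Since each test compares an upper bound of a total thickness with a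
capacity, the totals in a record may be replaced by larger numbers: every path still yields an
L-packing (`walk_spec`), whatever the rounding.

*Rounding.* It remains to replace the totals by members of a set of polynomial size
(`exists_rounding`). Colour the items of a sequence, one after the other, with `r + 1` colours such
that the `r + 1` largest items so far always have different colours: an item that enters this group
takes the colour of the item that it replaces (`exists_colouring`). Deleting the cheapest colour
loses at most the fraction `1 / (r + 1)` of the profit. At any time one deleted item, of size `d`
say, is among the `r + 1` largest; the other `r` are counted exactly, and everything else consists
of items of size at most `d`, so its total can be rounded up in each step to a multiple of
`d / (n + 1)`, at a total cost of at most `d`, the space that the deletion has gained. Only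
`n ^ O(r)` values occur (`RPos`); `r` is the denominator of `ε`. All sizes are multiplied by `n + 1`,
because the machine cannot divide.

*Machine.* The program `scheme` lists the rounded totals and all records, runs Bellman-Ford with
`n + 1` rounds over all pairs of records, and follows the best path from the empty packing. Programs
are verified with the predicate `Runs` (termination within a time bound in a state that satisfies a
postcondition): `Runs.of_loopFree` evaluates loop-free code, `Runs.forP` is the rule for counting
loops, and `Frame` provides that nothing changes which a program does not mention as a target.
If both arms are at most half as thick as the knapsack, every packing is an L-packing
(`IsPacking.isLPacking`).
-/

namespace LPack

/-! ### Verification of programs -/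

/-- The registers that occur as a target in `P`. -/
def Prog.regs : Prog → List ℕ
  | .skip => []
  | .const d _ => [d]
  | .copy d _ => [d]
  | .add d _ _ => [d]
  | .sub d _ _ => [d]
  | .load d _ _ => [d]
  | .store _ _ _ => []
  | .seq P Q => P.regs ++ Q.regs
  | .cond _ _ P Q => P.regs ++ Q.regs
  | .loop _ _ P => P.regs

/-- The arrays that occur as a target in `P`. -/
def Prog.arrs : Prog → List ℕ
  | .store m _ _ => [m]
  | .seq P Q => P.arrs ++ Q.arrs
  | .cond _ _ P Q => P.arrs ++ Q.arrs
  | .loop _ _ P => P.arrs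
  | _ => []

/-- The states `s` and `s'` agree on everything that `P` does not write. -/
structure Frame (P : Prog) (s s' : State) : Prop where
  reg : ∀ r, r ∉ P.regs → s'.reg r = s.reg r
  arr : ∀ a, a ∉ P.arrs → s'.arr a = s.arr a

theorem State.reg_setReg (s : State) (d v r : ℕ) :
    (s.setReg d v).reg r = if r = d then v else s.reg r := by
  simp [State.setReg, Function.update_apply]

theorem State.arr_setReg (s : State) (d v : ℕ) : (s.setReg d v).arr = s.arr := rfl

theorem State.reg_setArr (s : State) (a k v : ℕ) : (s.setArr a k v).reg = s.reg := rfl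

theorem State.arr_setArr (s : State) (a k v b : ℕ) :
    (s.setArr a k v).arr b = if b = a then Function.update (s.arr a) k v else s.arr b := by
  simp only [State.setArr, Function.update_apply]

theorem Frame.refl (P : Prog) (s : State) : Frame P s s := ⟨fun _ _ => rfl, fun _ _ => rfl⟩

theorem Frame.trans {P : Prog} {s s' s'' : State} (h : Frame P s s') (h' : Frame P s' s'') :
    Frame P s s'' :=
  ⟨fun r hr => (h'.reg r hr).trans (h.reg r hr), fun a ha => (h'.arr a ha).trans (h.arr a ha)⟩

theorem Frame.mono {P Q : Prog} {s s' : State} (h : Frame P s s') (hr : P.regs ⊆ Q.regs)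
    (ha : P.arrs ⊆ Q.arrs) : Frame Q s s' :=
  ⟨fun r hr' => h.reg r fun h' => hr' (hr h'), fun a ha' => h.arr a fun h' => ha' (ha h')⟩

theorem Exec.frame {P : Prog} {s s' : State} {t : ℕ} (h : Exec P s t s') : Frame P s s' := by
  induction h with
  | skip s => exact Frame.refl _ _
  | const d n s =>
    exact ⟨fun r hr => by simp_all [Prog.regs, State.reg_setReg], fun _ _ => rfl⟩
  | copy d a s =>
    exact ⟨fun r hr => by simp_all [Prog.regs, State.reg_setReg], fun _ _ => rfl⟩
  | add d a b s =>
    exact ⟨fun r hr => by simp_all [Prog.regs, State.reg_setReg], fun _ _ => rfl⟩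
  | sub d a b s =>
    exact ⟨fun r hr => by simp_all [Prog.regs, State.reg_setReg], fun _ _ => rfl⟩
  | load d m a s =>
    exact ⟨fun r hr => by simp_all [Prog.regs, State.reg_setReg], fun _ _ => rfl⟩
  | store m a b s =>
    exact ⟨fun _ _ => rfl, fun r hr => by simp_all [Prog.arrs, State.arr_setArr]⟩
  | seq _ _ ih ih' =>
    exact (ih.mono (by simp [Prog.regs]) (by simp [Prog.arrs])).trans
      (ih'.mono (by simp [Prog.regs]) (by simp [Prog.arrs]))
  | cond_true _ _ ih => exact ih.mono (by simp [Prog.regs]) (by simp [Prog.arrs])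
  | cond_false _ _ ih => exact ih.mono (by simp [Prog.regs]) (by simp [Prog.arrs])
  | loop_true _ _ _ ih ih' =>
    exact (ih.mono (by simp [Prog.regs]) (by simp [Prog.arrs])).trans ih'
  | loop_false _ => exact Frame.refl _ _

/-- Total correctness with a time bound: started in `s`, the program `P` halts after at most `B`
steps in a state that satisfies `Q`. -/
def Runs (P : Prog) (s : State) (B : ℕ) (Q : State → Prop) : Prop :=
  ∃ t s', Exec P s t s' ∧ t ≤ B ∧ Q s'

theorem Runs.mono {P : Prog} {s : State} {B B' : ℕ} {Q Q' : State → Prop} (h : Runs P s B Q)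
    (hB : B ≤ B') (hQ : ∀ s', Q s' → Frame P s s' → Q' s') : Runs P s B' Q' := by
  obtain ⟨t, s', he, ht, hq⟩ := h
  exact ⟨t, s', he, ht.trans hB, hQ _ hq he.frame⟩

theorem Runs.seq {P P' : Prog} {s : State} {B B' : ℕ} {Q Q' : State → Prop} (h : Runs P s B Q)
    (h' : ∀ s', Q s' → Frame P s s' → Runs P' s' B' Q') : Runs (P.seq P') s (B + B') Q' := by
  obtain ⟨t, s', he, ht, hq⟩ := h
  obtain ⟨t', s'', he', ht', hq'⟩ := h' s' hq he.frame
  exact ⟨t + t', s'', he.seq he', by omega, hq'⟩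

/-- Programs without loops. -/
def Prog.LoopFree : Prog → Prop
  | .seq P Q => P.LoopFree ∧ Q.LoopFree
  | .cond _ _ P Q => P.LoopFree ∧ Q.LoopFree
  | .loop _ _ _ => False
  | _ => True

/-- The final state of a program without loops (a loop is treated as `skip`). -/
def Prog.run : Prog → State → State
  | .skip, s => s
  | .const d n, s => s.setReg d n
  | .copy d a, s => s.setReg d (s.reg a)
  | .add d a b, s => s.setReg d (s.reg a + s.reg b)
  | .sub d a b, s => s.setReg d (s.reg a - s.reg b)
  | .load d m a, s => s.setReg d (s.arr m (s.reg a))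
  | .store m a b, s => s.setArr m (s.reg a) (s.reg b)
  | .seq P Q, s => Q.run (P.run s)
  | .cond a b P Q, s => if s.reg a < s.reg b then P.run s else Q.run s
  | .loop _ _ _, s => s

/-- An upper bound for the number of steps of a program without loops. -/
def Prog.cost : Prog → ℕ
  | .seq P Q => P.cost + Q.cost
  | .cond _ _ P Q => P.cost + Q.cost + 1
  | _ => 1

theorem Prog.LoopFree.exec {P : Prog} (h : P.LoopFree) (s : State) :
    ∃ t ≤ P.cost, Exec P s t (P.run s) := by
  induction P generalizing s with
  | skip => exact ⟨1, le_rfl, .skip s⟩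
  | const d n => exact ⟨1, le_rfl, .const d n s⟩
  | copy d a => exact ⟨1, le_rfl, .copy d a s⟩
  | add d a b => exact ⟨1, le_rfl, .add d a b s⟩
  | sub d a b => exact ⟨1, le_rfl, .sub d a b s⟩
  | load d m a => exact ⟨1, le_rfl, .load d m a s⟩
  | store m a b => exact ⟨1, le_rfl, .store m a b s⟩
  | seq P Q ihP ihQ =>
    obtain ⟨t, ht, h1⟩ := ihP h.1 s
    obtain ⟨t', ht', h2⟩ := ihQ h.2 (P.run s)
    exact ⟨t + t', Nat.add_le_add ht ht', h1.seq h2⟩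
  | cond a b P Q ihP ihQ =>
    by_cases hab : s.reg a < s.reg b
    · obtain ⟨t, ht, h1⟩ := ihP h.1 s
      refine ⟨t + 1, by simp only [Prog.cost]; omega, ?_⟩
      simpa only [Prog.run, if_pos hab] using Exec.cond_true hab h1
    · obtain ⟨t, ht, h1⟩ := ihQ h.2 s
      refine ⟨t + 1, by simp only [Prog.cost]; omega, ?_⟩
      simpa only [Prog.run, if_neg hab] using Exec.cond_false hab h1
  | loop a b P _ => exact h.elim

theorem Runs.of_loopFree {P : Prog} {s : State} {Q : State → Prop} (h : P.LoopFree)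
    (hQ : Q (P.run s)) : Runs P s P.cost Q := by
  obtain ⟨t, ht, he⟩ := h.exec s
  exact ⟨t, _, he, ht, hQ⟩

/-- Counting loop: run `P` for the values `0, 1, …` of register `i` below the content of
register `n`. Register `9` is used for the constant `1`. -/
def forP (i n : ℕ) (P : Prog) : Prog :=
  .seq (.const i 0) (.loop i n (.seq P (.seq (.const 9 1) (.add i i 9))))

/-- Loop rule with an invariant indexed by the number of completed rounds. The body of the loop
may use that everything which the loop does not write is as in the state before the loop. -/
theorem Runs.forP {i n : ℕ} {P : Prog} {s₀ : State} {B : ℕ} {m : ℕ} (Inv : ℕ → State → Prop)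
    (hm : s₀.reg n = m) (hi : i ∉ P.regs) (hn : n ∉ (forP i n P).regs) (hi9 : i ≠ 9)
    (h0 : Inv 0 (s₀.setReg i 0))
    (hstep : ∀ k < m, ∀ s, s.reg i = k → Frame (LPack.forP i n P) s₀ s → Inv k s →
      Runs P s B fun s' => Inv (k + 1) ((s'.setReg 9 1).setReg i (k + 1))) :
    Runs (LPack.forP i n P) s₀ (m * (B + 3) + 2) (Inv m) := by
  set L := Prog.loop i n (.seq P (.seq (.const 9 1) (.add i i 9))) with hL
  have key : ∀ d k, k + d = m → ∀ s, s.reg i = k → Frame (LPack.forP i n P) s₀ s → Inv k s →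
      Runs L s (d * (B + 3) + 1) (Inv m) := by
    intro d
    induction d with
    | zero =>
      intro k hk s hs hF hI
      refine ⟨1, s, Exec.loop_false ?_, by omega, ?_⟩
      · rw [hs, hF.reg n hn, hm]; omega
      · simpa [show k = m by omega] using hI
    | succ d ih =>
      intro k hk s hs hF hI
      obtain ⟨t, s', he, ht, hq⟩ := hstep k (by omega) s hs hF hI
      have hs' : s'.reg i = k := by rw [he.frame.reg i hi, hs]
      have hbody : Exec (.seq P (.seq (.const 9 1) (.add i i 9))) s (t + (1 + 1))
          ((s'.setReg 9 1).setReg i (k + 1)) := by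
        refine he.seq ((Exec.const 9 1 s').seq ?_)
        have := Exec.add i i 9 (s'.setReg 9 1)
        simpa [State.reg_setReg, hi9, hs'] using this
      have hF' : Frame (LPack.forP i n P) s₀ ((s'.setReg 9 1).setReg i (k + 1)) :=
        hF.trans (hbody.frame.mono (by simp [LPack.forP, Prog.regs])
          (by simp [LPack.forP, Prog.arrs]))
      obtain ⟨t', s'', he', ht', hq'⟩ := ih (k + 1) (by omega) _
        (by simp [State.reg_setReg]) hF' hq
      refine ⟨t + (1 + 1) + t' + 1, s'', Exec.loop_true ?_ hbody he', ?_, hq'⟩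
      · rw [hs, hF.reg n hn, hm]; omega
      · rw [Nat.succ_mul]; omega
  obtain ⟨t, s', he, ht, hq⟩ := key m 0 (by omega) (s₀.setReg i 0) (by simp [State.reg_setReg])
    ((Exec.const i 0 s₀).frame.mono (by simp [LPack.forP, Prog.regs])
      (by simp [LPack.forP, Prog.arrs])) h0
  exact ⟨1 + t, s', (Exec.const i 0 s₀).seq he, by omega, hq⟩

/-! ### Scaling -/

/-- `mulS d a i`: register `d` receives the product of the registers `7` and `a`. -/
def mulS (d a i : ℕ) : Prog := .seq (.const d 0) (forP i 7 (.add d d a))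

theorem mulS_spec {d a i : ℕ} (s : State) (hda : d ≠ a) (hi : i ∉ [d, a, 7, 9]) (hd : d ∉ [7, 9])
    (ha : a ≠ 9) :
    Runs (mulS d a i) s (s.reg 7 * 4 + 3) fun s' => s'.reg d = s.reg 7 * s.reg a := by
  simp only [List.mem_cons, List.not_mem_nil, or_false, not_or] at hi hd
  obtain ⟨hid, hia, hi7, hi9⟩ := hi
  have h := Runs.forP (i := i) (n := 7) (P := .add d d a) (s₀ := s.setReg d 0) (B := 1)
    (m := s.reg 7) (fun k s' => s'.reg d = k * s.reg a)
    (by simp [State.reg_setReg, Ne.symm hd.1]) (by simp [Prog.regs, hid])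
    (by simp [forP, Prog.regs, Ne.symm hd.1, Ne.symm hi7]) hi9
    (by simp [State.reg_setReg, Ne.symm hid]) ?_
  · refine (Runs.seq (Runs.of_loopFree (P := .const d 0) (Q := fun s' => s' = s.setReg d 0)
      trivial rfl) (B' := s.reg 7 * 4 + 2) (Q' := fun s' => s'.reg d = s.reg 7 * s.reg a)
      ?_).mono (by simp [Prog.cost]; omega) fun _ h _ => h
    rintro _ rfl -
    exact h
  · intro k _ s' _ hF hI
    refine Runs.of_loopFree trivial ?_
    have := hF.reg a (by simp [forP, Prog.regs, Ne.symm hda, Ne.symm hia, ha])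
    simp only [State.reg_setReg, Ne.symm hda, if_false] at this
    simp [Prog.run, State.reg_setReg, hd.2, Ne.symm hid, hI, this, Nat.succ_mul]

/-- The first `reg cnt` cells of the array `dst` receive `reg 7` times the cells of `src`. -/
def scaleArr (src dst cnt : ℕ) : Prog :=
  forP 61 cnt (.seq (.load 62 src 61) (.seq (mulS 63 62 60) (.store dst 61 63)))

theorem scaleArr_spec {src dst cnt : ℕ} (s : State) (hne : dst ≠ src) (hc : cnt < 9)
    (hdst : s.arr dst = fun _ => 0) (hsrc : ∀ k, s.reg cnt ≤ k → s.arr src k = 0) :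
    Runs (scaleArr src dst cnt) s (s.reg cnt * (s.reg 7 * 4 + 8) + 2) fun s' =>
      s'.arr dst = fun k => s.reg 7 * s.arr src k := by
  have hr : ∀ r < 9, r ∉ (scaleArr src dst cnt).regs := by
    intro r hr
    simp [scaleArr, forP, mulS, Prog.regs]
    omega
  have hsrcm : src ∉ (scaleArr src dst cnt).arrs := by
    simp [scaleArr, forP, mulS, Prog.arrs, Ne.symm hne]
  refine (Runs.forP (B := s.reg 7 * 4 + 5) (m := s.reg cnt)
    (fun m s' => ∀ k, s'.arr dst k = if k < m then s.reg 7 * s.arr src k else 0)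
    rfl ?_ (hr _ hc) (by norm_num) ?_ ?_).mono le_rfl ?_
  · simp [Prog.regs, mulS, forP]
  · simp [State.arr_setReg, hdst]
  · intro k hk s' hk' hF hI
    have e7 : s'.reg 7 = s.reg 7 := hF.reg 7 (hr 7 (by norm_num))
    refine (Runs.seq (Runs.of_loopFree (P := .load 62 src 61)
      (Q := fun s'' => s'' = s'.setReg 62 (s.arr src k)) trivial
      (by simp [Prog.run, hF.arr src hsrcm, hk'])) (B' := s.reg 7 * 4 + 4) ?_).mono
      (by simp [Prog.cost]; omega) (fun _ h _ => h)
    rintro s'' rfl -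
    refine (Runs.seq (mulS_spec (d := 63) (a := 62) (i := 60) _ (by norm_num) (by norm_num)
      (by norm_num) (by norm_num)) (B' := 1) ?_).mono ?_ (fun _ h _ => h)
    · intro s3 h3 F3
      refine Runs.of_loopFree (P := .store dst 61 63) trivial ?_
      have e1 : s3.reg 61 = k := by
        rw [F3.reg 61 (by simp [mulS, forP, Prog.regs])]; simp [State.reg_setReg, hk']
      have e2 : s3.arr dst = s'.arr dst := by
        rw [F3.arr dst (by simp [mulS, forP, Prog.arrs])]; rfl
      simp only [State.reg_setReg, e7] at h3
      intro k'
      simp only [Prog.run, State.arr_setReg, State.arr_setArr, if_true, Function.update_apply, e1,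
        e2, hI k', h3]
      norm_num
      split_ifs <;> first | omega | simp_all
    · simp [State.reg_setReg, e7]
  · intro s' h _
    funext k
    rw [h k]
    split_ifs with hk
    · rfl
    · rw [hsrc k (not_lt.1 hk), mul_zero]

/-! ### Rounded positions -/

/-- The rounded positions, in units of `1 / s`: multiples `q * h i` with `q ≤ s ^ 2`, to which up
to `r` numbers `s * h i` have been added. -/
def RPos (s : ℕ) (h : ℕ → ℕ) (m : ℕ) : ℕ → ℕ → Prop
  | 0, v => v = 0 ∨ ∃ i < m, ∃ q ≤ s * s, v = q * h i
  | r + 1, v => RPos s h m r v ∨ ∃ u, RPos s h m r u ∧ ∃ i < m, v = u + s * h i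

/-- The value `v` occurs in the list that is stored in the array `A` and has length `reg c`. -/
def Has (A c : ℕ) (s : State) (v : ℕ) : Prop := ∃ k < s.reg c, s.arr A k = v

/-- `push A c x`: append the content of register `x` to the list in array `A` of length
`reg c`. -/
def push (A c x : ℕ) : Prog := .seq (.store A c x) (.seq (.const 66 1) (.add c c 66))

/-- List the rounded positions in the array `A`, and their number in register `c`; the sizes
are in array `h`, the scaled sizes in array `sh`, and their number in register `m`. -/
def buildT (h sh A c m : ℕ) : Prog :=
  .seq (.seq (.const 64 0) (.seq (.store A 64 64) (.const c 1)))
    (.seq (forP 61 m (.seq (.seq (.load 62 h 61) (.const 63 0))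
      (forP 65 13 (.seq (.add 63 63 62) (push A c 63)))))
    (forP 67 1 (.seq (.copy 68 c) (forP 69 68 (.seq (.load 71 A 69)
      (forP 61 m (.seq (.seq (.load 62 sh 61) (.add 62 71 62)) (push A c 62))))))))

/-- The number of listed positions after `r` rounds. -/
def numPos (s m r : ℕ) : ℕ := (1 + m * (s * s)) * (m + 1) ^ r

theorem push_run {A c x : ℕ} (s : State) (hc : c ≠ 66) :
    (push A c x).run s = ((s.setArr A (s.reg c) (s.reg x)).setReg 66 1).setReg c (s.reg c + 1) := by
  simp [push, Prog.run, State.reg_setReg, State.reg_setArr, hc]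

/-- The first loop of `buildT` lists the multiples of the sizes. -/
theorem buildT_multiples {h A c m : ℕ} (hA : A ≠ h) (hc : c = 14 ∨ c = 15) (hm : m < 9)
    (s : State) (h0 : Has A c s 0) (hc1 : s.reg c = 1) :
    Runs (forP 61 m (.seq (.seq (.load 62 h 61) (.const 63 0))
      (forP 65 13 (.seq (.add 63 63 62) (push A c 63))))) s
      (s.reg m * (s.reg 13 * 7 + 7) + 2) fun s' =>
      s'.reg c = 1 + s.reg m * s.reg 13 ∧ Has A c s' 0 ∧
        ∀ i < s.reg m, ∀ q ≤ s.reg 13, Has A c s' (q * s.arr h i) := by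
  refine (Runs.forP (B := s.reg 13 * 7 + 4) (m := s.reg m)
    (fun k s' => s'.reg c = 1 + k * s.reg 13 ∧ Has A c s' 0 ∧
        ∀ i < k, ∀ q ≤ s.reg 13, Has A c s' (q * s.arr h i)) rfl ?_ ?_ (by norm_num) ?_ ?_).mono
    le_rfl fun _ h _ => h
  · rcases hc with rfl | rfl <;> simp [forP, push, Prog.regs]
  · rcases hc with rfl | rfl <;> simp [forP, push, Prog.regs] <;> omega
  · have : c ≠ 61 := by omega
    simpa [State.reg_setReg, this, hc1, Has, State.arr_setReg] using h0
  · intro k hk s1 hk1 F1 ⟨I1, I2, I3⟩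
    have e13 : s1.reg 13 = s.reg 13 := F1.reg 13 (by
      rcases hc with rfl | rfl <;> simp [forP, push, Prog.regs])
    have eh : s1.arr h = s.arr h := F1.arr h (by simp [forP, push, Prog.arrs, Ne.symm hA])
    refine (Runs.seq (Runs.of_loopFree (P := .seq (.load 62 h 61) (.const 63 0))
      (Q := fun s2 => s2 = (s1.setReg 62 (s.arr h k)).setReg 63 0) (by simp [Prog.LoopFree])
      (by simp [Prog.run, eh, hk1])) (B' := s.reg 13 * 7 + 2) ?_).mono
      (by simp [Prog.cost]; omega) (fun _ h _ => h)
    rintro s2 rfl -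
    refine (Runs.forP (B := 4) (m := s.reg 13)
      (fun q s' => s'.reg c = 1 + k * s.reg 13 + q ∧ s'.reg 63 = q * s.arr h k ∧ Has A c s' 0 ∧
        (∀ i < k, ∀ q ≤ s.reg 13, Has A c s' (q * s.arr h i)) ∧
        ∀ q' ≤ q, Has A c s' (q' * s.arr h k)) ?_ ?_ ?_ (by norm_num) ?_ ?_).mono le_rfl ?_
    · simp [State.reg_setReg, e13]
    · rcases hc with rfl | rfl <;> simp [push, Prog.regs]
    · rcases hc with rfl | rfl <;> simp [forP, push, Prog.regs]
    · rcases hc with rfl | rfl <;> simpa [State.reg_setReg, Has, State.arr_setReg, I1, I2] using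
        ⟨by simpa [Has, I1] using I2, by simpa [Has, I1] using I3, by simpa [Has, I1] using I2⟩
    · intro q hq s2 hq2 F2 ⟨J1, J2, J3, J4, J5⟩
      have e62 : s2.reg 62 = s.arr h k := by
        rw [F2.reg 62 (by rcases hc with rfl | rfl <;> simp [forP, push, Prog.regs])]; simp [State.reg_setReg]
      refine (Runs.of_loopFree (P := .seq (.add 63 63 62) (push A c 63))
        (Q := fun s3 => _) (by simp [Prog.LoopFree, push]) ?_)
      set s3 := (((Prog.add 63 63 62).seq (push A c 63)).run s2) with hs3
      rw [Prog.run, push_run _ (by omega)] at hs3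
      have ec : s3.reg c = s2.reg c + 1 := by
        rcases hc with rfl | rfl <;>
          simp [hs3, Prog.run, State.reg_setReg]
      have e63 : s3.reg 63 = (q + 1) * s.arr h k := by
        rcases hc with rfl | rfl <;>
          simp [hs3, Prog.run, State.reg_setReg, State.reg_setArr, J2, e62, Nat.succ_mul]
      have eA : s3.arr A = Function.update (s2.arr A) (s2.reg c) ((q + 1) * s.arr h k) := by
        rcases hc with rfl | rfl <;>
          simp [hs3, Prog.run, State.reg_setReg, State.arr_setReg, State.arr_setArr, J2, e62,
            Nat.succ_mul]
      have hold : ∀ v, Has A c s2 v → Has A c ((s3.setReg 9 1).setReg 65 (q + 1)) v := by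
        rintro v ⟨j, hj, hv⟩
        refine ⟨j, ?_, ?_⟩
        · rcases hc with rfl | rfl <;> simp [State.reg_setReg] <;> omega
        · rw [State.arr_setReg, State.arr_setReg, eA, Function.update_of_ne (by omega), hv]
      refine ⟨?_, ?_, hold _ J3, fun i hi q' hq' => hold _ (J4 i hi q' hq'), ?_⟩
      · rcases hc with rfl | rfl <;> simp [State.reg_setReg] <;> omega
      · simpa [State.reg_setReg] using e63
      · intro q' hq'
        rcases Nat.lt_or_ge q q' with hlt | hle
        · obtain rfl : q' = q + 1 := by omega
          refine ⟨s2.reg c, ?_, ?_⟩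
          · rcases hc with rfl | rfl <;> simp [State.reg_setReg] <;> omega
          · rw [State.arr_setReg, State.arr_setReg, eA, Function.update_self]
        · exact hold _ (J5 q' hle)
    · rintro s' ⟨J1, -, J3, J4, J5⟩ -
      have hold : ∀ v, Has A c s' v → Has A c ((s'.setReg 9 1).setReg 61 (k + 1)) v := by
        rcases hc with rfl | rfl <;> simp [Has, State.reg_setReg, State.arr_setReg]
      refine ⟨?_, hold _ J3, fun i hi q hq => hold _ ?_⟩
      · rcases hc with rfl | rfl <;> simp [State.reg_setReg, J1, Nat.succ_mul] <;> ring
      · rcases Nat.lt_or_ge i k with hlt | hle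
        · exact J4 i hlt q hq
        · obtain rfl : i = k := by omega
          exact J5 q hq


/-- One round of the second loop of `buildT` adds every scaled size to every listed position. -/
theorem buildT_round {sh A c m : ℕ} (hA : A ≠ sh) (hc : c = 14 ∨ c = 15) (hm : m < 9) (s : State)
    (X : ℕ → Prop) (hX : ∀ v, X v → Has A c s v) :
    Runs (.seq (.copy 68 c) (forP 69 68 (.seq (.load 71 A 69)
      (forP 61 m (.seq (.seq (.load 62 sh 61) (.add 62 71 62)) (push A c 62)))))) s
      (s.reg c * (s.reg m * 8 + 6) + 3) fun s' =>
      s'.reg c = s.reg c * (s.reg m + 1) ∧ (∀ v, X v → Has A c s' v) ∧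
        ∀ v, X v → ∀ i < s.reg m, Has A c s' (v + s.arr sh i) := by
  have hmc : m ≠ c := by omega
  refine (Runs.seq (Runs.of_loopFree (P := .copy 68 c) (Q := fun s' => s' = s.setReg 68 (s.reg c))
    trivial rfl) (B' := s.reg c * (s.reg m * 8 + 6) + 2) (Q' := fun s' =>
      s'.reg c = s.reg c * (s.reg m + 1) ∧ (∀ k < s.reg c, s'.arr A k = s.arr A k) ∧
        ∀ k < s.reg c, ∀ i < s.reg m, Has A c s' (s.arr A k + s.arr sh i)) ?_).mono
      (by simp [Prog.cost]; omega) ?_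
  · rintro s0 rfl -
    refine (Runs.forP (B := s.reg m * 8 + 3) (m := s.reg c)
      (fun n s' => s'.reg c = s.reg c + n * s.reg m ∧
        (∀ k < s.reg c, s'.arr A k = s.arr A k) ∧
        ∀ k < n, ∀ i < s.reg m, Has A c s' (s.arr A k + s.arr sh i)) ?_ ?_ ?_ (by norm_num)
      ?_ ?_).mono le_rfl ?_
    · simp [State.reg_setReg]
    · rcases hc with rfl | rfl <;> simp [forP, push, Prog.regs]
    · rcases hc with rfl | rfl <;> simp [forP, push, Prog.regs]
    · rcases hc with rfl | rfl <;> simp [State.reg_setReg, State.arr_setReg]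
    · intro n hn s1 hs1 F1 ⟨I1, I2, I3⟩
      have em : s1.reg m = s.reg m := by
        rw [F1.reg m (by rcases hc with rfl | rfl <;> simp [forP, push, Prog.regs] <;> omega)]
        rw [State.reg_setReg, if_neg (by omega)]
      have esh : s1.arr sh = s.arr sh :=
        F1.arr sh (by simp [forP, push, Prog.arrs, Ne.symm hA])
      refine (Runs.seq (Runs.of_loopFree (P := .load 71 A 69)
        (Q := fun s2 => s2 = s1.setReg 71 (s.arr A n)) trivial
        (by simp [Prog.run, hs1, I2 n hn])) (B' := s.reg m * 8 + 2) ?_).mono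
        (by simp [Prog.cost]; omega) (fun _ h _ => h)
      rintro s2 rfl -
      refine (Runs.forP (B := 5) (m := s.reg m)
        (fun i s' => s'.reg c = s.reg c + n * s.reg m + i ∧
        (∀ k < s.reg c, s'.arr A k = s.arr A k) ∧
        (∀ k < n, ∀ i < s.reg m, Has A c s' (s.arr A k + s.arr sh i)) ∧
        ∀ i' < i, Has A c s' (s.arr A n + s.arr sh i')) ?_ ?_ ?_ (by norm_num) ?_ ?_).mono
        le_rfl ?_
      · rw [State.reg_setReg, if_neg (by omega), em]
      · rcases hc with rfl | rfl <;> simp [push, Prog.regs]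
      · rcases hc with rfl | rfl <;> simp [forP, push, Prog.regs] <;> omega
      · refine ⟨?_, I2, ?_, by simp⟩
        · rcases hc with rfl | rfl <;> simp [State.reg_setReg, I1]
        · rcases hc with rfl | rfl <;> simpa [Has, State.reg_setReg, State.arr_setReg] using I3
      · intro i hi s2 hs2 F2 ⟨J1, J2, J3, J4⟩
        have e71 : s2.reg 71 = s.arr A n := by
          rw [F2.reg 71 (by rcases hc with rfl | rfl <;> simp [forP, push, Prog.regs])]
          simp [State.reg_setReg]
        have esh2 : s2.arr sh = s.arr sh := by
          rw [F2.arr sh (by simp [forP, push, Prog.arrs, Ne.symm hA]), State.arr_setReg, esh]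
        refine (Runs.of_loopFree (P := .seq (.seq (.load 62 sh 61) (.add 62 71 62)) (push A c 62))
          (Q := fun s3 => _) (by simp [Prog.LoopFree, push]) ?_)
        set s3 := (((Prog.seq (.load 62 sh 61) (.add 62 71 62)).seq (push A c 62)).run s2) with hs3
        rw [Prog.run, push_run _ (by omega)] at hs3
        have ec : s3.reg c = s2.reg c + 1 := by
          rcases hc with rfl | rfl <;> simp [hs3, Prog.run, State.reg_setReg]
        have eA : s3.arr A = Function.update (s2.arr A) (s2.reg c) (s.arr A n + s.arr sh i) := by
          rcases hc with rfl | rfl <;>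
            simp [hs3, Prog.run, State.reg_setReg, State.arr_setReg, State.arr_setArr, e71,
              esh2, hs2]
        have hold : ∀ v, Has A c s2 v → Has A c ((s3.setReg 9 1).setReg 61 (i + 1)) v := by
          rintro v ⟨j, hj, hv⟩
          refine ⟨j, ?_, ?_⟩
          · rcases hc with rfl | rfl <;> simp [State.reg_setReg] <;> omega
          · rw [State.arr_setReg, State.arr_setReg, eA, Function.update_of_ne (by omega), hv]
        refine ⟨?_, ?_, fun k hk i hi => hold _ (J3 k hk i hi), ?_⟩
        · rcases hc with rfl | rfl <;> simp [State.reg_setReg] <;> omega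
        · intro k hk
          rw [State.arr_setReg, State.arr_setReg, eA, Function.update_of_ne (by omega), J2 k hk]
        · intro i' hi'
          rcases Nat.lt_or_ge i' i with hlt | hle
          · exact hold _ (J4 i' hlt)
          · obtain rfl : i' = i := by omega
            refine ⟨s2.reg c, ?_, ?_⟩
            · rcases hc with rfl | rfl <;> simp [State.reg_setReg] <;> omega
            · rw [State.arr_setReg, State.arr_setReg, eA, Function.update_self]
      · rintro s' ⟨J1, J2, J3, J4⟩ -
        refine ⟨?_, J2, ?_⟩
        · rcases hc with rfl | rfl <;> simp [State.reg_setReg, J1, Nat.succ_mul] <;> ring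
        · intro k hk i hi
          have : Has A c s' (s.arr A k + s.arr sh i) := by
            rcases Nat.lt_or_ge k n with hlt | hle
            · exact J3 k hlt i hi
            · obtain rfl : k = n := by omega
              exact J4 i hi
          rcases hc with rfl | rfl <;> simpa [Has, State.reg_setReg, State.arr_setReg] using this
    · rintro s' ⟨J1, J2, J3⟩ -
      exact ⟨by rw [J1]; ring, J2, J3⟩
  · rintro s' ⟨J1, J2, J3⟩ -
    refine ⟨J1, ?_, ?_⟩
    · intro v hv
      obtain ⟨k, hk, rfl⟩ := hX v hv
      exact ⟨k, by rw [J1]; nlinarith, J2 k hk⟩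
    · intro v hv i hi
      obtain ⟨k, hk, rfl⟩ := hX v hv
      exact J3 k hk i hi

/-- The number of steps in which `buildT` lists the positions. -/
def timePos (s m r : ℕ) : ℕ :=
  m * (s * s * 7 + 7) + 5 + (r * (numPos s m r * (m * 8 + 6) + 6) + 2)

theorem numPos_le {s m r r' : ℕ} (h : r ≤ r') : numPos s m r ≤ numPos s m r' :=
  Nat.mul_le_mul_left _ (Nat.pow_le_pow_right (by omega) h)

theorem buildT_spec {h sh A c m : ℕ} (hA : A ≠ h) (hA' : A ≠ sh) (hc : c = 14 ∨ c = 15)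
    (hm : m < 9) (s : State) {σ : ℕ} (h13 : s.reg 13 = σ * σ)
    (hsh : ∀ i, s.arr sh i = σ * s.arr h i) :
    Runs (buildT h sh A c m) s (timePos σ (s.reg m) (s.reg 1)) fun s' =>
      s'.reg c = numPos σ (s.reg m) (s.reg 1) ∧
        ∀ v, RPos σ (s.arr h) (s.reg m) (s.reg 1) v → Has A c s' v := by
  have hm64 : m ≠ 64 := by omega
  have hmc : m ≠ c := by omega
  have h1c : 1 ≠ c := by omega
  have h13c : 13 ≠ c := by omega
  refine (Runs.seq (Runs.of_loopFree
    (P := .seq (.const 64 0) (.seq (.store A 64 64) (.const c 1)))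
    (Q := fun s' => (s'.reg c = 1 ∧ Has A c s' 0) ∧ s'.reg m = s.reg m ∧ s'.reg 13 = s.reg 13 ∧
      s'.reg 1 = s.reg 1 ∧ s'.arr h = s.arr h ∧ s'.arr sh = s.arr sh) (by simp [Prog.LoopFree]) ?_)
    (fun s1 ⟨⟨g1, g2⟩, em, e13, e1, eh, esh⟩ _ => Runs.seq
      ((buildT_multiples hA hc hm s1 g2 g1).mono (by rw [em, e13]) fun _ h _ => h)
      fun s2 ⟨g3, g4, g5⟩ F2 =>
      Runs.forP (B := numPos σ (s.reg m) (s.reg 1) * (s.reg m * 8 + 6) + 3) (m := s.reg 1)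
        (fun r s' => s'.reg c = numPos σ (s.reg m) r ∧
          ∀ v, RPos σ (s.arr h) (s.reg m) r v → Has A c s' v) ?_ ?_ ?_ (by norm_num) ?_ ?_)).mono
      (B := 3 + ((s.reg m * (s.reg 13 * 7 + 7) + 2) +
        (s.reg 1 * (numPos σ (s.reg m) (s.reg 1) * (s.reg m * 8 + 6) + 6) + 2))) ?_
      fun _ h _ => h
  · simp [Prog.run, State.reg_setReg, State.reg_setArr, State.arr_setReg, State.arr_setArr,
      hm64, hmc, Ne.symm hA, Ne.symm hA', Has, h1c, h13c]
  · rw [F2.reg 1 (by rcases hc with rfl | rfl <;> simp [forP, push, Prog.regs]), e1]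
  · rcases hc with rfl | rfl <;> simp [forP, push, Prog.regs]
  · rcases hc with rfl | rfl <;> simp [forP, push, Prog.regs]
  · rw [e13, em, h13] at g3
    rw [e13, em, h13, eh] at g5
    refine ⟨?_, ?_⟩
    · rw [State.reg_setReg, if_neg (by omega), g3, numPos]; ring
    · rintro v (rfl | ⟨i, hi, q, hq, rfl⟩)
      · rcases hc with rfl | rfl <;> simpa [Has, State.reg_setReg, State.arr_setReg] using g4
      · rcases hc with rfl | rfl <;>
          simpa [Has, State.reg_setReg, State.arr_setReg] using g5 i hi q hq
  · intro r hr s3 _ F3 ⟨J1, J2⟩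
    have em3 : s3.reg m = s.reg m := by
      rw [F3.reg m (by rcases hc with rfl | rfl <;> simp [forP, push, Prog.regs] <;> omega),
        F2.reg m (by rcases hc with rfl | rfl <;> simp [forP, push, Prog.regs] <;> omega), em]
    have esh3 : s3.arr sh = s.arr sh := by
      rw [F3.arr sh (by simp [forP, push, Prog.arrs, Ne.symm hA']),
        F2.arr sh (by simp [forP, push, Prog.arrs, Ne.symm hA']), esh]
    refine (buildT_round hA' hc hm s3 _ J2).mono ?_ ?_
    · rw [J1, em3]
      have := Nat.mul_le_mul_right (s.reg m * 8 + 6) (numPos_le (s := σ) (m := s.reg m) hr.le)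
      omega
    · rintro s4 ⟨K1, K2, K3⟩ -
      refine ⟨?_, ?_⟩
      · rw [State.reg_setReg, if_neg (by omega), State.reg_setReg, if_neg (by omega), K1, J1, em3,
          numPos, numPos]
        ring
      · intro v hv
        have : Has A c s4 v := by
          rcases hv with hv | ⟨u, hu, i, hi, rfl⟩
          · exact K2 v hv
          · have := K3 u hu i (by omega)
            rwa [esh3, hsh] at this
        rcases hc with rfl | rfl <;> simpa [Has, State.reg_setReg, State.arr_setReg] using this
  · rw [timePos, h13]; omega

/-! ### The list of records -/

/-- The record with index `k`: indices `i`, `j` of a horizontal and a vertical item and rounded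
positions `t`, `l`. -/
def IsRec (s : State) (k i j t l : ℕ) : Prop :=
  s.arr 30 k = i ∧ s.arr 31 k = j ∧ s.arr 32 k = t ∧ s.arr 33 k = l

/-- The list of records of `s'` extends the one of `s` by `d` entries. -/
structure Extends (s s' : State) (d : ℕ) : Prop where
  len : s'.reg 18 = s.reg 18 + d
  old : ∀ k < s.reg 18, ∀ i j t l, IsRec s k i j t l → IsRec s' k i j t l

theorem Extends.trans {s s' s'' : State} {d d' : ℕ} (h : Extends s s' d) (h' : Extends s' s'' d') :
    Extends s s'' (d + d') :=
  ⟨by rw [h'.len, h.len]; ring,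
    fun k hk i j t l hr => h'.old k (by rw [h.len]; omega) i j t l (h.old k hk i j t l hr)⟩

/-- Some record is `(i, j, t, l)`. -/
def HasRec (s : State) (i j t l : ℕ) : Prop := ∃ k < s.reg 18, IsRec s k i j t l

theorem HasRec.extends {s s' : State} {d i j t l : ℕ} (h : HasRec s i j t l)
    (he : Extends s s' d) : HasRec s' i j t l := by
  obtain ⟨k, hk, hr⟩ := h
  exact ⟨k, by rw [he.len]; omega, he.old k hk i j t l hr⟩

theorem Extends.setReg {s s' : State} {d : ℕ} (h : Extends s s' d) {r v : ℕ} (hr : r ≠ 18) :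
    Extends s (s'.setReg r v) d :=
  ⟨by rw [State.reg_setReg, if_neg hr.symm, h.len], h.old⟩

/-- A loop whose body extends the list of records by `d` entries, among which are those described
by `Tgt`. -/
theorem Runs.forP_extends {i n : ℕ} {P : Prog} {s₀ : State} {B m d : ℕ}
    (Tgt : ℕ → ℕ → ℕ → ℕ → ℕ → Prop)
    (hm : s₀.reg n = m) (hi : i ∉ P.regs) (hn : n ∉ (LPack.forP i n P).regs) (hi9 : i ≠ 9)
    (hi18 : i ≠ 18)
    (hstep : ∀ k < m, ∀ s, s.reg i = k → Frame (LPack.forP i n P) s₀ s →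
      Runs P s B fun s' => Extends s s' d ∧ ∀ i j t l, Tgt k i j t l → HasRec s' i j t l) :
    Runs (LPack.forP i n P) s₀ (m * (B + 3) + 2) fun s' => Extends s₀ s' (m * d) ∧
      ∀ k < m, ∀ i j t l, Tgt k i j t l → HasRec s' i j t l := by
  refine Runs.forP (fun n s' => Extends s₀ s' (n * d) ∧
      ∀ k < n, ∀ i j t l, Tgt k i j t l → HasRec s' i j t l) hm hi hn hi9 ?_ ?_
  · refine ⟨⟨?_, fun _ _ _ _ _ _ h => h⟩, by simp⟩
    rw [State.reg_setReg, if_neg hi18.symm]; simp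
  · intro k hk s hs hF ⟨I1, I2⟩
    refine (hstep k hk s hs hF).mono le_rfl ?_
    rintro s' ⟨J1, J2⟩ -
    have J1' : Extends s ((s'.setReg 9 1).setReg i (k + 1)) d :=
      (J1.setReg (by norm_num)).setReg hi18
    refine ⟨by rw [Nat.succ_mul]; exact I1.trans J1', fun k' hk' a b t l ht => ?_⟩
    rcases Nat.lt_or_ge k' k with hlt | hle
    · exact (I2 k' hlt a b t l ht).extends J1'
    · obtain rfl : k' = k := by omega
      have := J2 a b t l ht
      have e : ((s'.setReg 9 1).setReg i (k' + 1)).reg 18 = s'.reg 18 := by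
        rw [State.reg_setReg, if_neg hi18.symm, State.reg_setReg, if_neg (by norm_num)]
      simpa [HasRec, IsRec, e, State.arr_setReg] using this

/-- Append the record given by the loop registers `72` to `75`. -/
def pushRec : Prog :=
  .seq (.load 62 26 74) (.seq (.load 63 27 75) (.seq (.store 30 18 72) (.seq (.store 31 18 73)
    (.seq (.store 32 18 62) (.seq (.store 33 18 63) (.seq (.const 66 1) (.add 18 18 66)))))))

/-- List the records: first the start record `(nH, nV, 0, 0)`, then all records with `i ≤ nH`,
`j ≤ nV` and listed positions `t`, `l`. -/
def buildK : Prog :=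
  .seq (.seq (.const 64 0) (.seq (.store 30 64 5) (.seq (.store 31 64 6) (.seq (.store 32 64 64)
    (.seq (.store 33 64 64) (.seq (.const 18 1) (.seq (.add 16 5 18) (.add 17 6 18))))))))
    (forP 72 16 (forP 73 17 (forP 74 14 (forP 75 15 pushRec))))

theorem pushRec_spec (s : State) {i j a b : ℕ} (hi : s.reg 72 = i) (hj : s.reg 73 = j)
    (ha : s.reg 74 = a) (hb : s.reg 75 = b) :
    Runs pushRec s 8 fun s' => Extends s s' 1 ∧ HasRec s' i j (s.arr 26 a) (s.arr 27 b) := by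
  refine Runs.of_loopFree (by simp [pushRec, Prog.LoopFree]) ?_
  refine ⟨⟨?_, ?_⟩, s.reg 18, ?_, ?_⟩
  · simp [pushRec, Prog.run, State.reg_setReg, State.reg_setArr]
  · rintro k hk i j t l ⟨rfl, rfl, rfl, rfl⟩
    simp [pushRec, Prog.run, State.reg_setReg, State.reg_setArr, State.arr_setReg,
      State.arr_setArr, IsRec, Function.update_of_ne hk.ne]
  · simp [pushRec, Prog.run, State.reg_setReg, State.reg_setArr]
  · simp [pushRec, Prog.run, State.reg_setReg, State.reg_setArr, State.arr_setReg,
      State.arr_setArr, IsRec, hi, hj, ha, hb]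

/-- The number of steps in which `buildK` lists the records. -/
def timeRec (nH nV lH lV : ℕ) : ℕ :=
  8 + ((nH + 1) * ((nV + 1) * (lH * (lV * 11 + 5) + 5) + 5) + 2)

theorem buildK_spec (s : State) :
    Runs buildK s (timeRec (s.reg 5) (s.reg 6) (s.reg 14) (s.reg 15)) fun s' =>
      s'.reg 18 = 1 + (s.reg 5 + 1) * ((s.reg 6 + 1) * (s.reg 14 * s.reg 15)) ∧
      IsRec s' 0 (s.reg 5) (s.reg 6) 0 0 ∧
      ∀ i ≤ s.reg 5, ∀ j ≤ s.reg 6, ∀ t l, Has 26 14 s t → Has 27 15 s l →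
        HasRec s' i j t l := by
  refine (Runs.seq (Runs.of_loopFree (Q := fun s' => (s'.reg 18 = 1 ∧
    IsRec s' 0 (s.reg 5) (s.reg 6) 0 0) ∧ s'.reg 16 = s.reg 5 + 1 ∧ s'.reg 17 = s.reg 6 + 1 ∧
    s'.reg 14 = s.reg 14 ∧ s'.reg 15 = s.reg 15 ∧ s'.arr 26 = s.arr 26 ∧ s'.arr 27 = s.arr 27)
    (by simp [Prog.LoopFree]) ?_) (B' := (s.reg 5 + 1) * ((s.reg 6 + 1) *
      (s.reg 14 * (s.reg 15 * 11 + 5) + 5) + 5) + 2) ?_).mono (Q := fun s' =>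
        ∃ s1, (s1.reg 18 = 1 ∧ IsRec s1 0 (s.reg 5) (s.reg 6) 0 0) ∧
          Extends s1 s' ((s.reg 5 + 1) * ((s.reg 6 + 1) * (s.reg 14 * (s.reg 15 * 1)))) ∧
          ∀ i < s.reg 5 + 1, ∀ i' j t l, (∃ j' < s.reg 6 + 1, ∃ a < s.reg 14, ∃ b < s.reg 15,
            i' = i ∧ j = j' ∧ t = s.arr 26 a ∧ l = s.arr 27 b) → HasRec s' i' j t l)
      (by simp [Prog.cost, timeRec]) ?_
  · simp [Prog.run, State.reg_setReg, State.reg_setArr, State.arr_setReg, State.arr_setArr, IsRec]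
  · rintro s1 ⟨h1, e16, e17, e14, e15, e26, e27⟩ -
    refine (Runs.forP_extends (B := (s.reg 6 + 1) * (s.reg 14 * (s.reg 15 * 11 + 5) + 5) + 2)
      (d := (s.reg 6 + 1) * (s.reg 14 * (s.reg 15 * 1)))
      (fun i i' j t l => ∃ j' < s.reg 6 + 1, ∃ a < s.reg 14, ∃ b < s.reg 15,
            i' = i ∧ j = j' ∧ t = s.arr 26 a ∧ l = s.arr 27 b)
      e16 (by decide) (by decide) (by decide) (by decide) ?_).mono le_rfl
      fun s' hs' _ => ⟨s1, h1, hs'⟩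
    intro i hi s2 hi2 F2
    refine (Runs.forP_extends (B := s.reg 14 * (s.reg 15 * 11 + 5) + 2)
      (d := s.reg 14 * (s.reg 15 * 1))
      (fun j i' j' t l => ∃ a < s.reg 14, ∃ b < s.reg 15,
            i' = i ∧ j' = j ∧ t = s.arr 26 a ∧ l = s.arr 27 b)
      (by rw [F2.reg 17 (by decide), e17]) (by decide) (by decide) (by decide) (by decide)
      ?_).mono le_rfl fun s' hs' _ => ⟨hs'.1, ?_⟩
    · intro j hj s3 hj3 F3
      refine (Runs.forP_extends (B := s.reg 15 * 11 + 2) (d := s.reg 15 * 1)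
        (fun a i' j' t l => ∃ b < s.reg 15,
            i' = i ∧ j' = j ∧ t = s.arr 26 a ∧ l = s.arr 27 b)
        (by rw [F3.reg 14 (by decide), F2.reg 14 (by decide), e14]) (by decide) (by decide)
        (by decide) (by decide) ?_).mono le_rfl fun s' hs' _ => ⟨hs'.1, ?_⟩
      · intro a ha s4 ha4 F4
        refine (Runs.forP_extends (B := 8) (d := 1)
          (fun b i' j' t l => i' = i ∧ j' = j ∧ t = s.arr 26 a ∧ l = s.arr 27 b)
          (by rw [F4.reg 15 (by decide), F3.reg 15 (by decide), F2.reg 15 (by decide), e15])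
          (by decide) (by decide) (by decide) (by decide) ?_).mono le_rfl
          fun s' hs' _ => ⟨hs'.1, ?_⟩
        · intro b hb s5 hb5 F5
          refine (pushRec_spec s5 (i := i) (j := j) (a := a) (b := b)
            (by rw [F5.reg 72 (by decide), F4.reg 72 (by decide), F3.reg 72 (by decide), hi2])
            (by rw [F5.reg 73 (by decide), F4.reg 73 (by decide), hj3])
            (by rw [F5.reg 74 (by decide), ha4]) hb5).mono le_rfl ?_
          rw [F5.arr 26 (by decide), F4.arr 26 (by decide), F3.arr 26 (by decide),
            F2.arr 26 (by decide), e26, F5.arr 27 (by decide), F4.arr 27 (by decide),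
            F3.arr 27 (by decide), F2.arr 27 (by decide), e27]
          rintro s' ⟨h, h'⟩ -
          refine ⟨h, ?_⟩
          rintro _ _ _ _ ⟨rfl, rfl, rfl, rfl⟩
          exact h'
        · rintro i' j' t l ⟨b, hb, h⟩
          exact hs'.2 b hb i' j' t l h
      · rintro i' j' t l ⟨a, ha, h⟩
        exact hs'.2 a ha i' j' t l h
    · rintro i' j' t l ⟨j', hj', a, ha, b, hb, h1, rfl, h2⟩
      exact hs'.2 _ hj' i' _ t l ⟨a, ha, b, hb, h1, rfl, h2⟩
  · rintro s' ⟨s1, ⟨h1, h2⟩, h3, h4⟩ -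
    refine ⟨by rw [h3.len, h1, mul_one], h3.old 0 (by omega) _ _ _ _ h2, ?_⟩
    rintro i hi j hj t l ⟨a, ha, rfl⟩ ⟨b, hb, rfl⟩
    exact h4 i (by omega) i j _ _ ⟨j, by omega, a, ha, b, hb, rfl, rfl, rfl, rfl⟩

/-! ### Longest paths -/

/-- The condition for appending the item `i'` to a partial packing with record `(i, j, t, l)`,
with the new record `(i', j', t', l')`. Here `len` and `th` are the scaled lengths and
thicknesses of the items of one of the two kinds; the items are taken in order of decreasing
`len i - i`, which is injective on the items. -/
structure Edge (len th : ℕ → ℕ) (m cap side i j t l i' j' t' l' : ℕ) : Prop where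
  other : j' = j
  pos_other : l' = l
  lt : i' < m
  key : len i' - i' < len i - i
  pos : t + th i' ≤ t'
  pos_le : t' ≤ cap
  fits : l + len i' ≤ side

/-- `guardLe a b P`: run `P` if register `a` is at most register `b`. -/
def guardLe (a b : ℕ) (P : Prog) : Prog := .cond b a .skip P

/-- `guardLt a b P`: run `P` if register `a` is smaller than register `b`. -/
def guardLt (a b : ℕ) (P : Prog) : Prog := .cond a b P .skip

/-- Load what is needed to test the pair of the records with the indices in registers `40`
and `41`. -/
def loadPair (ai aj ap al len th pr : ℕ) : Prog :=
  .seq (.load 42 ai 40) (.seq (.load 43 aj 40) (.seq (.load 44 ap 40) (.seq (.load 45 al 40)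
  (.seq (.load 46 ai 41) (.seq (.load 47 aj 41) (.seq (.load 48 ap 41) (.seq (.load 49 al 41)
  (.seq (.load 50 len 42) (.seq (.sub 50 50 42) (.seq (.load 53 len 46) (.seq (.sub 51 53 46)
  (.seq (.add 53 45 53) (.seq (.load 52 th 46) (.seq (.add 52 44 52)
  (.seq (.load 54 pr 46) (.seq (.load 55 34 41) (.seq (.add 54 54 55)
  (.load 56 34 40))))))))))))))))))

/-- If the pair of loaded records is an edge that improves the value of the first record, update
the value and the successor of that record. -/
def testPair (m cap : ℕ) : Prog :=
  guardLe 47 43 (guardLe 43 47 (guardLe 49 45 (guardLe 45 49 (guardLt 46 m (guardLt 51 50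
  (guardLe 52 48 (guardLe 48 cap (guardLe 53 10 (guardLt 56 54
    (.seq (.store 34 40 54) (.seq (.const 57 1) (.seq (.add 57 41 57)
      (.store 35 40 57)))))))))))))

/-- Relaxation of one pair of records for one of the two kinds of items. -/
def relaxPair (ai aj ap al len th pr m cap : ℕ) : Prog :=
  .seq (loadPair ai aj ap al len th pr) (testPair m cap)

/-- Relaxation of the pair of records in registers `40` and `41`. -/
def relaxBoth : Prog :=
  .seq (relaxPair 30 31 32 33 20 21 2 5 12) (relaxPair 31 30 33 32 23 24 5 6 11)

/-- The edge relation of a state between two records that differ by a horizontal item. -/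
def EdgeH (s : State) (x y : ℕ) : Prop :=
  Edge (s.arr 20) (s.arr 21) (s.reg 5) (s.reg 12) (s.reg 10)
    (s.arr 30 x) (s.arr 31 x) (s.arr 32 x) (s.arr 33 x)
    (s.arr 30 y) (s.arr 31 y) (s.arr 32 y) (s.arr 33 y)

/-- The edge relation of a state between two records that differ by a vertical item. -/
def EdgeV (s : State) (x y : ℕ) : Prop :=
  Edge (s.arr 23) (s.arr 24) (s.reg 6) (s.reg 11) (s.reg 10)
    (s.arr 31 x) (s.arr 30 x) (s.arr 33 x) (s.arr 32 x)
    (s.arr 31 y) (s.arr 30 y) (s.arr 33 y) (s.arr 32 y)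

/-- There is an edge of profit `p` from the record `x` to the record `y`. -/
def Step (s : State) (x y p : ℕ) : Prop :=
  (EdgeH s x y ∧ p = s.arr 2 (s.arr 30 y)) ∨ (EdgeV s x y ∧ p = s.arr 5 (s.arr 31 y))

/-- The effect of the relaxation of an edge from `x` to `y` of profit `p` (if `e` holds) on the
values and successors. -/
def Relaxed (e : Prop) (x y p : ℕ) (s s' : State) : Prop :=
  (e ∧ s.arr 34 x < p + s.arr 34 y ∧
    s'.arr 34 = Function.update (s.arr 34) x (p + s.arr 34 y) ∧
    s'.arr 35 = Function.update (s.arr 35) x (y + 1)) ∨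
  ((e → p + s.arr 34 y ≤ s.arr 34 x) ∧ s'.arr 34 = s.arr 34 ∧ s'.arr 35 = s.arr 35)

theorem guardLe_run (a b : ℕ) (P : Prog) (s : State) :
    (guardLe a b P).run s = if s.reg a ≤ s.reg b then P.run s else s := by
  simp only [guardLe, Prog.run]
  split_ifs <;> first | rfl | omega

theorem guardLt_run (a b : ℕ) (P : Prog) (s : State) :
    (guardLt a b P).run s = if s.reg a < s.reg b then P.run s else s := rfl

theorem testPair_run (m cap : ℕ) (s : State) :
    (testPair m cap).run s = if s.reg 47 ≤ s.reg 43 ∧ s.reg 43 ≤ s.reg 47 ∧ s.reg 49 ≤ s.reg 45 ∧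
      s.reg 45 ≤ s.reg 49 ∧ s.reg 46 < s.reg m ∧ s.reg 51 < s.reg 50 ∧ s.reg 52 ≤ s.reg 48 ∧
      s.reg 48 ≤ s.reg cap ∧ s.reg 53 ≤ s.reg 10 ∧ s.reg 56 < s.reg 54 then
      (((s.setArr 34 (s.reg 40) (s.reg 54)).setReg 57 1).setReg 57 (s.reg 41 + 1)).setArr 35
        (s.reg 40) (s.reg 41 + 1) else s := by
  simp only [testPair, guardLe_run, guardLt_run, ← ite_and]
  refine if_congr (by tauto) ?_ rfl
  simp [Prog.run, State.reg_setReg, State.reg_setArr]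

theorem loadPair_run (ai aj ap al len th pr : ℕ) (s s' : State)
    (hs' : s' = (loadPair ai aj ap al len th pr).run s) :
    s'.arr = s.arr ∧ s'.reg 42 = s.arr ai (s.reg 40) ∧ s'.reg 43 = s.arr aj (s.reg 40) ∧
    s'.reg 45 = s.arr al (s.reg 40) ∧ s'.reg 46 = s.arr ai (s.reg 41) ∧
    s'.reg 47 = s.arr aj (s.reg 41) ∧ s'.reg 48 = s.arr ap (s.reg 41) ∧
    s'.reg 49 = s.arr al (s.reg 41) ∧
    s'.reg 50 = s.arr len (s.arr ai (s.reg 40)) - s.arr ai (s.reg 40) ∧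
    s'.reg 51 = s.arr len (s.arr ai (s.reg 41)) - s.arr ai (s.reg 41) ∧
    s'.reg 52 = s.arr ap (s.reg 40) + s.arr th (s.arr ai (s.reg 41)) ∧
    s'.reg 53 = s.arr al (s.reg 40) + s.arr len (s.arr ai (s.reg 41)) ∧
    s'.reg 54 = s.arr pr (s.arr ai (s.reg 41)) + s.arr 34 (s.reg 41) ∧
    s'.reg 56 = s.arr 34 (s.reg 40) ∧ ∀ r < 42, s'.reg r = s.reg r := by
  simp only [loadPair, Prog.run] at hs'
  refine ⟨by rw [hs']; rfl, ?_, ?_, ?_, ?_, ?_, ?_, ?_, ?_, ?_, ?_, ?_, ?_, ?_, ?_⟩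
  on_goal 14 =>
    intro r hr
    rw [hs']
    simp only [State.reg_setReg]
    repeat rw [if_neg (by omega)]
  all_goals rw [hs']; simp [State.reg_setReg, State.arr_setReg]

theorem relaxPair_spec {ai aj ap al len th pr m cap : ℕ} (s : State)
    (hm : m < 40) (hcap : cap < 40) :
    Runs (relaxPair ai aj ap al len th pr m cap) s 44 fun s' =>
      Relaxed (Edge (s.arr len) (s.arr th) (s.reg m) (s.reg cap) (s.reg 10)
        (s.arr ai (s.reg 40)) (s.arr aj (s.reg 40)) (s.arr ap (s.reg 40)) (s.arr al (s.reg 40))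
        (s.arr ai (s.reg 41)) (s.arr aj (s.reg 41)) (s.arr ap (s.reg 41)) (s.arr al (s.reg 41)))
        (s.reg 40) (s.reg 41) (s.arr pr (s.arr ai (s.reg 41))) s s' := by
  refine (Runs.of_loopFree (by simp [relaxPair, loadPair, testPair, guardLe, guardLt,
    Prog.LoopFree]) ?_).mono (by simp [relaxPair, loadPair, testPair, guardLe, guardLt,
    Prog.cost]) fun _ h _ => h
  obtain ⟨harr, e42, e43, e45, e46, e47, e48, e49, e50, e51, e52, e53, e54, e56, hreg⟩ :=
    loadPair_run ai aj ap al len th pr s _ rfl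
  have hrun : (relaxPair ai aj ap al len th pr m cap).run s =
    (testPair m cap).run ((loadPair ai aj ap al len th pr).run s) := rfl
  rw [hrun, testPair_run]
  generalize (loadPair ai aj ap al len th pr).run s = s1 at *
  simp only [hreg m (by omega), hreg cap (by omega), hreg 10 (by norm_num),
    hreg 40 (by norm_num), hreg 41 (by norm_num), e43, e45, e46, e47, e48, e49, e50, e51, e52,
    e53, e54, e56]
  split_ifs with h
  · obtain ⟨a1, a2, a3, a4, a5, a6, a7, a8, a9, a10⟩ := h
    refine Or.inl ⟨⟨by omega, by omega, a5, a6, a7, a8, a9⟩, a10, ?_⟩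
    simp [State.arr_setReg, State.arr_setArr, harr]
  · refine Or.inr ⟨fun ⟨h1, h2, h3, h4, h5, h6, h7⟩ => not_lt.1 fun h' => h ?_, ?_⟩
    · exact ⟨h1.le, h1.ge, h2.le, h2.ge, h3, h4, h5, h6, h7, h'⟩
    · rw [harr]; exact ⟨rfl, rfl⟩

/-- Paths of a weighted relation on the numbers below `R`: `Path St R x n q` says that some path
that starts in `x` has `n` edges and total profit `q`. -/
inductive Path (St : ℕ → ℕ → ℕ → Prop) (R : ℕ) : ℕ → ℕ → ℕ → Prop
  | nil (x : ℕ) : Path St R x 0 0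
  | cons {x y p n q : ℕ} : St x y p → y < R → Path St R y n q → Path St R x (n + 1) (p + q)

/-- The values and successors are consistent: following the successor of a record loses no more
of the value than the profit of the edge. -/
def Sound (St : ℕ → ℕ → ℕ → Prop) (R : ℕ) (s : State) : Prop :=
  ∀ x < R, (s.arr 35 x = 0 ∧ s.arr 34 x = 0) ∨
    ∃ y < R, ∃ p, s.arr 35 x = y + 1 ∧ St x y p ∧ s.arr 34 x ≤ p + s.arr 34 y

theorem Relaxed.le {e : Prop} {x y p : ℕ} {s s' : State} (h : Relaxed e x y p s s') (z : ℕ) :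
    s.arr 34 z ≤ s'.arr 34 z := by
  rcases h with ⟨-, h1, h2, -⟩ | ⟨-, h2, -⟩
  · rw [h2, Function.update_apply]
    split_ifs with hz
    · rw [hz]; exact h1.le
    · exact le_rfl
  · rw [h2]

theorem Relaxed.improves {e : Prop} {x y p : ℕ} {s s' : State} (h : Relaxed e x y p s s')
    (he : e) : p + s.arr 34 y ≤ s'.arr 34 x := by
  rcases h with ⟨-, -, h2, -⟩ | ⟨h1, h2, -⟩
  · rw [h2, Function.update_self]
  · rw [h2]; exact h1 he

theorem Relaxed.sound {e : Prop} {x y p R : ℕ} {s s' : State} {St : ℕ → ℕ → ℕ → Prop}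
    (h : Relaxed e x y p s s') (he : e → St x y p) (hy : y < R) (hs : Sound St R s) :
    Sound St R s' := by
  have hle := h.le
  intro z hz
  rcases h with ⟨h0, h1, h2, h3⟩ | ⟨-, h2, h3⟩
  · by_cases hzx : z = x
    · subst hzx
      right
      refine ⟨y, hy, p, by rw [h3, Function.update_self], he h0, ?_⟩
      calc s'.arr 34 z = p + s.arr 34 y := by rw [h2, Function.update_self]
        _ ≤ p + s'.arr 34 y := Nat.add_le_add_left (hle y) p
    · have e4 : s'.arr 34 z = s.arr 34 z := by rw [h2, Function.update_of_ne hzx]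
      have e5 : s'.arr 35 z = s.arr 35 z := by rw [h3, Function.update_of_ne hzx]
      rcases hs z hz with ⟨a, b⟩ | ⟨y', hy', p', a, b, c⟩
      · exact Or.inl ⟨by rw [e5, a], by rw [e4, b]⟩
      · exact Or.inr ⟨y', hy', p', by rw [e5, a], b,
          e4.trans_le (c.trans (Nat.add_le_add_left (hle y') p'))⟩
  · rw [h2, h3]
    exact hs z hz

theorem step_of_frame {P : Prog} {s s' : State} (h : Frame P s s')
    (hr : ∀ r ∈ [5, 6, 10, 11, 12], r ∉ P.regs)
    (ha : ∀ a ∈ [2, 5, 20, 21, 23, 24, 30, 31, 32, 33], a ∉ P.arrs) : Step s' = Step s := by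
  simp only [List.forall_mem_cons] at hr ha
  obtain ⟨r5, r6, r10, r11, r12, -⟩ := hr
  obtain ⟨a2, a5, a20, a21, a23, a24, a30, a31, a32, a33, -⟩ := ha
  funext x y p
  simp only [Step, EdgeH, EdgeV, h.reg _ r5, h.reg _ r6, h.reg _ r10, h.reg _ r11, h.reg _ r12,
    h.arr _ a2, h.arr _ a5, h.arr _ a20, h.arr _ a21, h.arr _ a23, h.arr _ a24, h.arr _ a30,
    h.arr _ a31, h.arr _ a32, h.arr _ a33]

theorem relaxBoth_spec {s : State} {R x y : ℕ} (hx : s.reg 40 = x) (hy : s.reg 41 = y)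
    (hyR : y < R) (hs : Sound (Step s) R s) :
    Runs relaxBoth s 88 fun s' => Sound (Step s) R s' ∧ (∀ z, s.arr 34 z ≤ s'.arr 34 z) ∧
      ∀ p, Step s x y p → p + s.arr 34 y ≤ s'.arr 34 x := by
  refine Runs.seq (relaxPair_spec s (by norm_num) (by norm_num)) fun s1 h1 F1 =>
    (relaxPair_spec s1 (by norm_num) (by norm_num)).mono le_rfl fun s2 h2 _ => ?_
  have hS : Step s1 = Step s := step_of_frame F1 (by decide) (by decide)
  have e40 : s1.reg 40 = x := by rw [F1.reg 40 (by decide), hx]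
  have e41 : s1.reg 41 = y := by rw [F1.reg 41 (by decide), hy]
  rw [hx, hy] at h1
  rw [e40, e41] at h2
  change Relaxed (EdgeH s x y) x y _ s s1 at h1
  change Relaxed (EdgeV s1 x y) x y _ s1 s2 at h2
  refine ⟨h2.sound (fun h => ?_) hyR (h1.sound (fun h => Or.inl ⟨h, rfl⟩) hyR hs),
    fun z => (h1.le z).trans (h2.le z), ?_⟩
  · rw [← hS]; exact Or.inr ⟨h, rfl⟩
  · rintro p (⟨h, rfl⟩ | h)
    · exact (h1.improves h).trans (h2.le x)
    · rw [← F1.arr 31 (by decide), ← F1.arr 5 (by decide)] at h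
      have hE : EdgeV s1 x y := by
        simpa only [EdgeV, F1.reg 6 (by decide), F1.reg 10 (by decide), F1.reg 11 (by decide),
          F1.arr 23 (by decide), F1.arr 24 (by decide), F1.arr 30 (by decide),
          F1.arr 31 (by decide), F1.arr 32 (by decide), F1.arr 33 (by decide)] using h.1
      rw [h.2]
      exact (Nat.add_le_add_left (h1.le y) _).trans (h2.improves hE)

/-- Compute for every record, by rounds of relaxations, the value of the best path that starts
there, and the successor on such a path. -/
def bellmanFord : Prog := forP 70 7 (forP 40 18 (forP 41 18 relaxBoth))

/-- The number of steps of `bellmanFord` with `r` rounds on `R` records. -/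
def timeBF (r R : ℕ) : ℕ := r * (R * (R * 91 + 5) + 5) + 2

theorem bellmanFord_spec (s : State) (h34 : s.arr 34 = fun _ => 0) (h35 : s.arr 35 = fun _ => 0) :
    Runs bellmanFord s (timeBF (s.reg 7) (s.reg 18)) fun s' =>
      Sound (Step s) (s.reg 18) s' ∧
      ∀ x < s.reg 18, ∀ n ≤ s.reg 7, ∀ q, Path (Step s) (s.reg 18) x n q → q ≤ s'.arr 34 x := by
  refine Runs.forP (B := s.reg 18 * (s.reg 18 * 91 + 5) + 2) (fun r s' =>
    Sound (Step s) (s.reg 18) s' ∧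
      ∀ x < s.reg 18, ∀ n ≤ r, ∀ q, Path (Step s) (s.reg 18) x n q → q ≤ s'.arr 34 x)
    rfl (by decide) (by decide) (by decide) ?_ ?_
  · refine ⟨fun x _ => Or.inl ?_, ?_⟩
    · simp [State.arr_setReg, h34, h35]
    · rintro x - n hn q (_ | _)
      · exact Nat.zero_le _
      · omega
  · intro r _ s1 _ F1 ⟨I1, I2⟩
    have eS1 : Step s1 = Step s := step_of_frame F1 (by decide) (by decide)
    have e18 : s1.reg 18 = s.reg 18 := F1.reg 18 (by decide)
    refine (Runs.forP (B := s.reg 18 * 91 + 2) (m := s.reg 18) (fun k s' =>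
      Sound (Step s) (s.reg 18) s' ∧ (∀ z, s1.arr 34 z ≤ s'.arr 34 z) ∧
      ∀ x < k, ∀ y < s.reg 18, ∀ p, Step s x y p → p + s1.arr 34 y ≤ s'.arr 34 x)
      e18 (by decide) (by decide) (by decide) ⟨I1, fun _ => le_rfl, by simp⟩ ?_).mono le_rfl ?_
    · intro x hx s2 hx2 F2 ⟨J1, J2, J3⟩
      have eS2 : Step s2 = Step s :=
        (step_of_frame F2 (by decide) (by decide)).trans eS1
      refine (Runs.forP (B := 88) (m := s.reg 18) (fun k s' =>
        Sound (Step s) (s.reg 18) s' ∧ (∀ z, s2.arr 34 z ≤ s'.arr 34 z) ∧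
        ∀ y < k, ∀ p, Step s x y p → p + s1.arr 34 y ≤ s'.arr 34 x)
        (by rw [F2.reg 18 (by decide), e18]) (by decide) (by decide) (by decide)
        ⟨J1, fun _ => le_rfl, by simp⟩ ?_).mono le_rfl ?_
      · intro y hy s3 hy3 F3 ⟨K1, K2, K3⟩
        have eS3 : Step s3 = Step s :=
          (step_of_frame F3 (by decide) (by decide)).trans eS2
        have e40 : s3.reg 40 = x := by rw [F3.reg 40 (by decide), hx2]
        refine (relaxBoth_spec e40 hy3 hy (by rwa [eS3])).mono le_rfl ?_
        rintro s4 ⟨L1, L2, L3⟩ -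
        rw [eS3] at L1 L3
        refine ⟨L1, fun z => (K2 z).trans (L2 z), fun y' hy' p hp => ?_⟩
        rcases Nat.lt_or_ge y' y with hlt | hle
        · exact (K3 y' hlt p hp).trans (L2 x)
        · obtain rfl : y' = y := by omega
          exact (Nat.add_le_add_left ((J2 y').trans (K2 y')) p).trans (L3 p hp)
      · rintro s3 ⟨K1, K2, K3⟩ -
        refine ⟨K1, fun z => (J2 z).trans (K2 z), fun x' hx' y hy p hp => ?_⟩
        rcases Nat.lt_or_ge x' x with hlt | hle
        · exact (J3 x' hlt y hy p hp).trans (K2 x')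
        · obtain rfl : x' = x := by omega
          exact K3 y hy p hp
    · rintro s2 ⟨J1, J2, J3⟩ -
      refine ⟨J1, ?_⟩
      rintro x hx n hn q (_ | ⟨hst, hy, hp⟩)
      · exact Nat.zero_le _
      · rename_i y p n q
        exact (Nat.add_le_add_left (I2 y hy n (by omega) q hp) p).trans (J3 x hx y hy p hst)

/-! ### From paths to L-packings -/

namespace Instance

variable {I : Instance}

/-- Placing one more horizontal item at the right end of the horizontal box, on top of the other
horizontal items and to the right of all vertical items. -/
theorem Placement.IsLPacking.insert_hor {P P' : I.Placement} (hP : P.IsLPacking) {i : Fin I.numHor}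
    {Y : ℕ} (hi : Sum.inl i ∉ P.chosen) (hc : P'.chosen = insert (Sum.inl i) P.chosen)
    (hx : P'.x = Function.update P.x (Sum.inl i) (I.N - (I.hor i).width))
    (hy : P'.y = Function.update P.y (Sum.inl i) Y) (hw : (I.hor i).width ≤ I.N)
    (hh : Y + (I.hor i).height ≤ I.hL)
    (htop : ∀ i' : Fin I.numHor, Sum.inl i' ∈ P.chosen → P.top (Sum.inl i') ≤ Y)
    (hright : ∀ j : Fin I.numVer, Sum.inr j ∈ P.chosen →
      P.right (Sum.inr j) + (I.hor i).width ≤ I.N) : P'.IsLPacking := by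
  have ex : ∀ k ∈ P.chosen, P'.x k = P.x k := fun k hk => by
    rw [hx, Function.update_of_ne]; rintro rfl; exact hi hk
  have ey : ∀ k ∈ P.chosen, P'.y k = P.y k := fun k hk => by
    rw [hy, Function.update_of_ne]; rintro rfl; exact hi hk
  have er : ∀ k ∈ P.chosen, P'.right k = P.right k := fun k hk => by simp only [right, ex k hk]
  have et : ∀ k ∈ P.chosen, P'.top k = P.top k := fun k hk => by simp only [top, ey k hk]
  have ix : P'.x (Sum.inl i) = I.N - (I.hor i).width := by rw [hx, Function.update_self]
  have iy : P'.y (Sum.inl i) = Y := by rw [hy, Function.update_self]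
  have ir : P'.right (Sum.inl i) = I.N := by
    simp only [right, ix, item, Sum.elim_inl]; omega
  have it : P'.top (Sum.inl i) = Y + (I.hor i).height := by
    simp only [top, iy, item, Sum.elim_inl]
  have hdis : ∀ k ∈ P.chosen, P'.right k ≤ P'.x (Sum.inl i) ∨ P'.top k ≤ P'.y (Sum.inl i) := by
    rintro (i' | j) hk
    · right; rw [et _ hk, iy]; exact htop i' hk
    · left; rw [er _ hk, ix]; have := hright j hk; omega
  refine ⟨⟨fun i' hi' => ?_, fun j hj => ?_, ?_⟩, ?_⟩
  · rw [hc, Finset.mem_insert] at hi'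
    rcases hi' with h | h
    · rw [h, ir, it]; exact ⟨le_rfl, hh⟩
    · rw [er _ h, et _ h]; exact hP.hor_box i' h
  · rw [hc, Finset.mem_insert] at hj
    rcases hj with h | h
    · cases h
    · rw [er _ h, et _ h]; exact hP.ver_box j h
  · intro k hk k' hk' hne
    rw [hc, Finset.mem_insert] at hk hk'
    rcases hk with rfl | hk <;> rcases hk' with rfl | hk'
    · exact absurd rfl hne
    · have := hdis _ hk'; tauto
    · have := hdis _ hk; tauto
    · rw [er _ hk, er _ hk', et _ hk, et _ hk', ex _ hk, ex _ hk', ey _ hk, ey _ hk']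
      exact hP.disjoint k hk k' hk' hne
  · intro i' j hi' hj
    rw [hc, Finset.mem_insert] at hi' hj
    rcases hj with h | hj
    · cases h
    rcases hi' with h | hi'
    · left; rw [h, er _ hj, ix]; have := hright j hj; omega
    · rw [er _ hj, et _ hi', ex _ hi', ey _ hj]
      exact hP.left_or_above i' j hi' hj

/-- Placing one more vertical item at the top of the vertical box, to the right of the other
vertical items and above all horizontal items. -/
theorem Placement.IsLPacking.insert_ver {P P' : I.Placement} (hP : P.IsLPacking) {j : Fin I.numVer}
    {X : ℕ} (hj : Sum.inr j ∉ P.chosen) (hc : P'.chosen = insert (Sum.inr j) P.chosen)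
    (hx : P'.x = Function.update P.x (Sum.inr j) X)
    (hy : P'.y = Function.update P.y (Sum.inr j) (I.N - (I.ver j).height))
    (hh : (I.ver j).height ≤ I.N) (hw : X + (I.ver j).width ≤ I.wL)
    (hright : ∀ j' : Fin I.numVer, Sum.inr j' ∈ P.chosen → P.right (Sum.inr j') ≤ X)
    (htop : ∀ i : Fin I.numHor, Sum.inl i ∈ P.chosen →
      P.top (Sum.inl i) + (I.ver j).height ≤ I.N) : P'.IsLPacking := by
  have ex : ∀ k ∈ P.chosen, P'.x k = P.x k := fun k hk => by
    rw [hx, Function.update_of_ne]; rintro rfl; exact hj hk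
  have ey : ∀ k ∈ P.chosen, P'.y k = P.y k := fun k hk => by
    rw [hy, Function.update_of_ne]; rintro rfl; exact hj hk
  have er : ∀ k ∈ P.chosen, P'.right k = P.right k := fun k hk => by simp only [right, ex k hk]
  have et : ∀ k ∈ P.chosen, P'.top k = P.top k := fun k hk => by simp only [top, ey k hk]
  have ix : P'.x (Sum.inr j) = X := by rw [hx, Function.update_self]
  have iy : P'.y (Sum.inr j) = I.N - (I.ver j).height := by rw [hy, Function.update_self]
  have ir : P'.right (Sum.inr j) = X + (I.ver j).width := by
    simp only [right, ix, item, Sum.elim_inr]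
  have it : P'.top (Sum.inr j) = I.N := by
    simp only [top, iy, item, Sum.elim_inr]; omega
  have hdis : ∀ k ∈ P.chosen, P'.right k ≤ P'.x (Sum.inr j) ∨ P'.top k ≤ P'.y (Sum.inr j) := by
    rintro (i | j') hk
    · right; rw [et _ hk, iy]; have := htop i hk; omega
    · left; rw [er _ hk, ix]; exact hright j' hk
  refine ⟨⟨fun i' hi' => ?_, fun j' hj' => ?_, ?_⟩, ?_⟩
  · rw [hc, Finset.mem_insert] at hi'
    rcases hi' with h | h
    · cases h
    · rw [er _ h, et _ h]; exact hP.hor_box i' h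
  · rw [hc, Finset.mem_insert] at hj'
    rcases hj' with h | h
    · rw [h, ir, it]; exact ⟨hw, le_rfl⟩
    · rw [er _ h, et _ h]; exact hP.ver_box j' h
  · intro k hk k' hk' hne
    rw [hc, Finset.mem_insert] at hk hk'
    rcases hk with rfl | hk <;> rcases hk' with rfl | hk'
    · exact absurd rfl hne
    · have := hdis _ hk'; tauto
    · have := hdis _ hk; tauto
    · rw [er _ hk, er _ hk', et _ hk, et _ hk', ex _ hk, ex _ hk', ey _ hk, ey _ hk']
      exact hP.disjoint k hk k' hk' hne
  · intro i' j' hi' hj'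
    rw [hc, Finset.mem_insert] at hi' hj'
    rcases hi' with h | hi'
    · cases h
    rcases hj' with h | hj'
    · right; rw [h, et _ hi', iy]; have := htop i' hi'; omega
    · rw [er _ hj', et _ hi', ex _ hi', ey _ hj']
      exact hP.left_or_above i' j' hi' hj'

/-- The scaling factor `n + 1`. -/
def scale (I : Instance) : ℕ := I.numItems + 1

/-- The scaled widths of the horizontal items, and behind them, as an item that comes before all
others, a value larger than the scaled side of the knapsack. -/
def lenH (I : Instance) : ℕ → ℕ :=
  Function.update (fun k => I.scale * arrayOf (fun i => (I.hor i).width) k) I.numHor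
    (I.scale * I.N + 1 + I.numHor)

/-- The scaled heights of the vertical items, followed by a value as in `lenH`. -/
def lenV (I : Instance) : ℕ → ℕ :=
  Function.update (fun k => I.scale * arrayOf (fun j => (I.ver j).height) k) I.numVer
    (I.scale * I.N + 1 + I.numVer)

/-- The input is in place, with the scaled numbers, and nothing has been output yet. -/
structure Ready (I : Instance) (s : State) : Prop where
  r2 : s.reg 2 = I.N
  r5 : s.reg 5 = I.numHor
  r6 : s.reg 6 = I.numVer
  r7 : s.reg 7 = I.scale
  r10 : s.reg 10 = I.scale * I.N
  r11 : s.reg 11 = I.scale * I.wL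
  r12 : s.reg 12 = I.scale * I.hL
  a0 : s.arr 0 = arrayOf fun i => (I.hor i).width
  a1 : s.arr 1 = arrayOf fun i => (I.hor i).height
  a2 : s.arr 2 = arrayOf fun i => (I.hor i).profit
  a3 : s.arr 3 = arrayOf fun j => (I.ver j).width
  a4 : s.arr 4 = arrayOf fun j => (I.ver j).height
  a5 : s.arr 5 = arrayOf fun j => (I.ver j).profit
  a6 : s.arr 6 = fun _ => 0
  a9 : s.arr 9 = fun _ => 0
  a20 : s.arr 20 = I.lenH
  a21 : s.arr 21 = fun k => I.scale * arrayOf (fun i => (I.hor i).height) k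
  a23 : s.arr 23 = I.lenV
  a24 : s.arr 24 = fun k => I.scale * arrayOf (fun j => (I.ver j).width) k

theorem arrayOf_fin {n : ℕ} (f : Fin n → ℕ) (i : Fin n) : arrayOf f i = f i := by
  simp [arrayOf, i.2]

end Instance

open Instance

/-- Output the horizontal item in register `46` at height `reg 80`. -/
def placeHor : Prog :=
  .seq (.load 50 0 46) (.seq (.sub 50 2 50) (.seq (.store 7 46 50) (.seq (.store 8 46 80)
    (.seq (.store 6 46 66) (.seq (.load 50 1 46) (.add 80 80 50))))))

/-- Output the vertical item in register `47` at the horizontal position `reg 81`. -/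
def placeVer : Prog :=
  .seq (.load 50 4 47) (.seq (.sub 50 2 50) (.seq (.store 11 47 50) (.seq (.store 10 47 81)
    (.seq (.store 9 47 66) (.seq (.load 50 3 47) (.add 81 81 50))))))

/-- Follow the successor of the record in register `40`, and place the item of this edge. The
registers `80` and `81` hold the total height of the chosen horizontal items and the total width
of the chosen vertical items. -/
def walkBody : Prog :=
  .seq (.load 82 35 40) (.seq (.const 64 0) (.cond 64 82
    (.seq (.const 66 1) (.seq (.sub 41 82 66) (.seq (.load 43 31 40) (.seq (.load 46 30 41)
      (.seq (.load 47 31 41) (.seq (.copy 40 41)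
        (.cond 43 47 placeVer (.cond 47 43 placeVer placeHor))))))))
    .skip))

/-- Output the items of the path that starts in the first record. -/
def walk : Prog :=
  .seq (.seq (.const 40 0) (.seq (.const 80 0) (.const 81 0))) (forP 70 7 walkBody)

theorem walkBody_stop {s : State} (h : s.arr 35 (s.reg 40) = 0) :
    (walkBody.run s).arr = s.arr ∧ (walkBody.run s).reg 40 = s.reg 40 ∧
      (walkBody.run s).reg 80 = s.reg 80 ∧ (walkBody.run s).reg 81 = s.reg 81 := by
  simp [walkBody, Prog.run, State.reg_setReg, State.arr_setReg, h]

theorem walkBody_hor {s : State} {x y i : ℕ} (hx : s.reg 40 = x) (h : s.arr 35 x = y + 1)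
    (hij : s.arr 31 y = s.arr 31 x) (hi : s.arr 30 y = i) :
    (walkBody.run s).reg 40 = y ∧ (walkBody.run s).reg 80 = s.reg 80 + s.arr 1 i ∧
    (walkBody.run s).reg 81 = s.reg 81 ∧
    (walkBody.run s).arr 6 = Function.update (s.arr 6) i 1 ∧
    (walkBody.run s).arr 7 = Function.update (s.arr 7) i (s.reg 2 - s.arr 0 i) ∧
    (walkBody.run s).arr 8 = Function.update (s.arr 8) i (s.reg 80) ∧
    (walkBody.run s).arr 9 = s.arr 9 ∧ (walkBody.run s).arr 10 = s.arr 10 ∧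
    (walkBody.run s).arr 11 = s.arr 11 := by
  simp [walkBody, placeHor, Prog.run, State.reg_setReg, State.arr_setReg, State.reg_setArr,
    State.arr_setArr, hx, h, hij, hi]

theorem walkBody_ver {s : State} {x y j : ℕ} (hx : s.reg 40 = x) (h : s.arr 35 x = y + 1)
    (hj : s.arr 31 y = j) (hne : j ≠ s.arr 31 x) :
    (walkBody.run s).reg 40 = y ∧ (walkBody.run s).reg 81 = s.reg 81 + s.arr 3 j ∧
    (walkBody.run s).reg 80 = s.reg 80 ∧
    (walkBody.run s).arr 9 = Function.update (s.arr 9) j 1 ∧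
    (walkBody.run s).arr 11 = Function.update (s.arr 11) j (s.reg 2 - s.arr 4 j) ∧
    (walkBody.run s).arr 10 = Function.update (s.arr 10) j (s.reg 81) ∧
    (walkBody.run s).arr 6 = s.arr 6 ∧ (walkBody.run s).arr 7 = s.arr 7 ∧
    (walkBody.run s).arr 8 = s.arr 8 := by
  have key : ∀ P Q : Prog, ∀ s' : State, s'.reg 43 = s.arr 31 x → s'.reg 47 = j →
      (Prog.cond 43 47 P (.cond 47 43 P Q)).run s' = P.run s' := by
    intro P Q s' h1 h2
    simp only [Prog.run, h1, h2]
    split_ifs <;> first | rfl | omega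
  have e : walkBody.run s = placeVer.run ((((((((s.setReg 82 (y + 1)).setReg 64 0).setReg 66
      1).setReg 41 y).setReg 43 (s.arr 31 x)).setReg 46 (s.arr 30 y)).setReg 47 j).setReg 40 y) := by
    rw [← key placeVer placeHor _ (by simp [State.reg_setReg]) (by simp [State.reg_setReg])]
    simp [walkBody, Prog.run, State.reg_setReg, State.arr_setReg, hx, h, hj]
  rw [e]
  simp [placeVer, Prog.run, State.reg_setReg, State.arr_setReg, State.reg_setArr,
    State.arr_setArr]

/-- The number of items that may still be chosen after the record `x`. -/
def rank (I : Instance) (s : State) (x : ℕ) : ℕ :=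
  ((Finset.range I.numHor).filter fun i =>
    I.lenH i - i < I.lenH (s.arr 30 x) - s.arr 30 x).card +
  ((Finset.range I.numVer).filter fun j =>
    I.lenV j - j < I.lenV (s.arr 31 x) - s.arr 31 x).card

theorem rank_le (I : Instance) (s : State) (x : ℕ) : rank I s x ≤ I.numItems := by
  refine Nat.add_le_add ((Finset.card_filter_le _ _).trans (Finset.card_range _).le)
    ((Finset.card_filter_le _ _).trans (Finset.card_range _).le)

theorem card_filter_key_lt {key : ℕ → ℕ} {m i : ℕ} {a : ℕ} (hi : i < m) (h : key i < a) :
    ((Finset.range m).filter fun k => key k < key i).card <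
      ((Finset.range m).filter fun k => key k < a).card := by
  refine Finset.card_lt_card ⟨fun k hk => ?_, fun hs => ?_⟩
  · simp only [Finset.mem_filter] at hk ⊢
    exact ⟨hk.1, hk.2.trans h⟩
  · have := hs (Finset.mem_filter.2 ⟨Finset.mem_range.2 hi, h⟩)
    exact lt_irrefl _ (Finset.mem_filter.1 this).2

/-- The invariant of the walk in a record `x`: the output is an L-packing of the items that have
been passed, its profit and the value of `x` add up to at least `w`, and the record bounds the
space that is used. `s₀` is the state at the start of the walk. -/
structure WalkInv (I : Instance) (s₀ s : State) (w x : ℕ) : Prop where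
  reg : s.reg 40 = x
  lt : x < s₀.reg 18
  pos_hor : I.scale * s.reg 80 ≤ s₀.arr 32 x
  pos_ver : I.scale * s.reg 81 ≤ s₀.arr 33 x
  packing : (I.output s).IsLPacking
  hor : ∀ i : Fin I.numHor, Sum.inl i ∈ (I.output s).chosen →
    (I.output s).top (Sum.inl i) ≤ s.reg 80 ∧
      I.lenH (s₀.arr 30 x) - s₀.arr 30 x ≤ I.lenH i - i
  ver : ∀ j : Fin I.numVer, Sum.inr j ∈ (I.output s).chosen →
    (I.output s).right (Sum.inr j) ≤ s.reg 81 ∧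
      I.lenV (s₀.arr 31 x) - s₀.arr 31 x ≤ I.lenV j - j
  profit : w ≤ (I.output s).profit + s₀.arr 34 x

theorem lenH_of_lt {I : Instance} (i : Fin I.numHor) :
    I.lenH i = I.scale * (I.hor i).width := by
  rw [lenH, Function.update_of_ne (by have := i.2; omega), arrayOf_fin]

theorem lenV_of_lt {I : Instance} (j : Fin I.numVer) :
    I.lenV j = I.scale * (I.ver j).height := by
  rw [lenV, Function.update_of_ne (by have := j.2; omega), arrayOf_fin]

theorem output_insert_hor {I : Instance} {s s' : State} (i : Fin I.numHor) {a b : ℕ}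
    (h6 : s'.arr 6 = Function.update (s.arr 6) i 1)
    (h7 : s'.arr 7 = Function.update (s.arr 7) i a) (h8 : s'.arr 8 = Function.update (s.arr 8) i b)
    (h9 : s'.arr 9 = s.arr 9) (h10 : s'.arr 10 = s.arr 10) (h11 : s'.arr 11 = s.arr 11) :
    (I.output s').chosen = insert (Sum.inl i) (I.output s).chosen ∧
    (I.output s').x = Function.update (I.output s).x (Sum.inl i) a ∧
    (I.output s').y = Function.update (I.output s).y (Sum.inl i) b := by
  refine ⟨?_, ?_, ?_⟩
  · ext (k | k)
    · by_cases hk : k = i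
      · simp [output, h6, hk]
      · simp [output, h6, Function.update_apply, Fin.val_inj, hk]
    · simp [output, h9]
  · funext k
    rcases k with k | k
    · simp [output, h7, Function.update_apply, Fin.val_inj]
    · simp [output, h10]
  · funext k
    rcases k with k | k
    · simp [output, h8, Function.update_apply, Fin.val_inj]
    · simp [output, h11]

theorem output_insert_ver {I : Instance} {s s' : State} (j : Fin I.numVer) {a b : ℕ}
    (h9 : s'.arr 9 = Function.update (s.arr 9) j 1)
    (h10 : s'.arr 10 = Function.update (s.arr 10) j a)
    (h11 : s'.arr 11 = Function.update (s.arr 11) j b)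
    (h6 : s'.arr 6 = s.arr 6) (h7 : s'.arr 7 = s.arr 7) (h8 : s'.arr 8 = s.arr 8) :
    (I.output s').chosen = insert (Sum.inr j) (I.output s).chosen ∧
    (I.output s').x = Function.update (I.output s).x (Sum.inr j) a ∧
    (I.output s').y = Function.update (I.output s).y (Sum.inr j) b := by
  refine ⟨?_, ?_, ?_⟩
  · ext (k | k)
    · simp [output, h6]
    · by_cases hk : k = j
      · simp [output, h9, hk]
      · simp [output, h9, Function.update_apply, Fin.val_inj, hk]
  · funext k
    rcases k with k | k
    · simp [output, h7]
    · simp [output, h10, Function.update_apply, Fin.val_inj]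
  · funext k
    rcases k with k | k
    · simp [output, h8]
    · simp [output, h11, Function.update_apply, Fin.val_inj]

/-- Following an edge of a horizontal item preserves the invariant of the walk. -/
theorem walk_hor {I : Instance} {s₀ s : State} {w x y p : ℕ} (hR : Ready I s₀)
    (hF : Frame walk s₀ s) (hI : WalkInv I s₀ s w x) (hnx : s₀.arr 35 x = y + 1)
    (hy : y < s₀.reg 18) (hE : EdgeH s₀ x y) (hp : p = s₀.arr 2 (s₀.arr 30 y))
    (hw : s₀.arr 34 x ≤ p + s₀.arr 34 y) :
    WalkInv I s₀ (walkBody.run s) w y ∧ rank I s₀ y < rank I s₀ x := by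
  obtain ⟨e1, e2, e3, e4, e5, e6, e7⟩ := hE
  rw [hR.r5] at e3
  rw [hR.a20] at e4 e7
  rw [hR.a21] at e5
  rw [hR.r12] at e6
  rw [hR.r10] at e7
  obtain ⟨i, hi⟩ : ∃ i : Fin I.numHor, s₀.arr 30 y = i := ⟨⟨_, e3⟩, rfl⟩
  rw [hi] at e4 e5 e7
  rw [lenH_of_lt] at e7
  simp only [arrayOf_fin] at e5
  rw [hR.a2, hi, arrayOf_fin] at hp
  have hs : 0 < I.scale := Nat.succ_pos _
  obtain ⟨g1, g2, g3, g6, g7, g8, g9, g10, g11⟩ := walkBody_hor (s := s) hI.reg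
    (by rw [hF.arr 35 (by decide), hnx]) (by rw [hF.arr 31 (by decide), e1])
    (by rw [hF.arr 30 (by decide), hi])
  rw [hF.arr 1 (by decide), hR.a1, arrayOf_fin] at g2
  rw [hF.reg 2 (by decide), hF.arr 0 (by decide), hR.r2, hR.a0, arrayOf_fin] at g7
  obtain ⟨o1, o2, o3⟩ := output_insert_hor i g6 g7 g8 g9 g10 g11
  have hnot : Sum.inl i ∉ (I.output s).chosen := fun h => by
    have := (hI.hor i h).2; omega
  have hX : s.reg 81 + (I.hor i).width ≤ I.N := by
    refine Nat.le_of_mul_le_mul_left ?_ hs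
    rw [mul_add]
    exact (Nat.add_le_add_right hI.pos_ver _).trans e7
  have hY : I.scale * (s.reg 80 + (I.hor i).height) ≤ s₀.arr 32 y := by
    rw [mul_add]
    exact (Nat.add_le_add_right hI.pos_hor _).trans e5
  have hpack : (I.output (walkBody.run s)).IsLPacking := by
    refine hI.packing.insert_hor hnot o1 o2 o3 (by omega) ?_ (fun i' h => (hI.hor i' h).1) ?_
    · exact Nat.le_of_mul_le_mul_left (hY.trans e6) hs
    · intro j hj
      have := (hI.ver j hj).1
      omega
  refine ⟨⟨g1, hy, by rw [g2]; exact hY, by rw [g3, e2]; exact hI.pos_ver, hpack, ?_, ?_, ?_⟩, ?_⟩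
  · intro i' hi'
    rw [o1, Finset.mem_insert] at hi'
    rw [hi, g2]
    by_cases h : i' = i
    · subst h
      simp [Placement.top, o3, item]
    · have hi'' : Sum.inl i' ∈ (I.output s).chosen :=
        hi'.resolve_left fun h' => h (Sum.inl_injective h')
      have := hI.hor i' hi''
      refine ⟨?_, by omega⟩
      have e : (I.output (walkBody.run s)).top (Sum.inl i') = (I.output s).top (Sum.inl i') := by
        simp [Placement.top, o3, h]
      rw [e]; omega
  · intro j hj
    rw [o1, Finset.mem_insert] at hj
    have := hI.ver j (hj.resolve_left (by simp))
    rw [e1, g3]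
    refine ⟨?_, this.2⟩
    have e : (I.output (walkBody.run s)).right (Sum.inr j) = (I.output s).right (Sum.inr j) := by
      simp [Placement.right, o2]
    rw [e]; exact this.1
  · have : (I.output (walkBody.run s)).profit = (I.hor i).profit + (I.output s).profit := by
      rw [Placement.profit, o1, Finset.sum_insert hnot]; rfl
    have := hI.profit
    omega
  · simp only [rank, e1, hi]
    exact Nat.add_lt_add_right (card_filter_key_lt (key := fun k => I.lenH k - k) i.2 e4) _

/-- Following an edge of a vertical item preserves the invariant of the walk. -/
theorem walk_ver {I : Instance} {s₀ s : State} {w x y p : ℕ} (hR : Ready I s₀)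
    (hF : Frame walk s₀ s) (hI : WalkInv I s₀ s w x) (hnx : s₀.arr 35 x = y + 1)
    (hy : y < s₀.reg 18) (hE : EdgeV s₀ x y) (hp : p = s₀.arr 5 (s₀.arr 31 y))
    (hw : s₀.arr 34 x ≤ p + s₀.arr 34 y) :
    WalkInv I s₀ (walkBody.run s) w y ∧ rank I s₀ y < rank I s₀ x := by
  obtain ⟨e1, e2, e3, e4, e5, e6, e7⟩ := hE
  rw [hR.r6] at e3
  rw [hR.a23] at e4 e7
  rw [hR.a24] at e5
  rw [hR.r11] at e6
  rw [hR.r10] at e7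
  obtain ⟨j, hj⟩ : ∃ j : Fin I.numVer, s₀.arr 31 y = j := ⟨⟨_, e3⟩, rfl⟩
  rw [hj] at e4 e5 e7
  rw [lenV_of_lt] at e7
  simp only [arrayOf_fin] at e5
  rw [hR.a5, hj, arrayOf_fin] at hp
  have hs : 0 < I.scale := Nat.succ_pos _
  obtain ⟨g1, g2, g3, g9, g11, g10, g6, g7, g8⟩ := walkBody_ver (s := s) hI.reg
    (by rw [hF.arr 35 (by decide), hnx]) (by rw [hF.arr 31 (by decide), hj])
    (by rw [hF.arr 31 (by decide)]; rintro h; rw [h] at e4; exact lt_irrefl _ e4)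
  rw [hF.arr 3 (by decide), hR.a3, arrayOf_fin] at g2
  rw [hF.reg 2 (by decide), hF.arr 4 (by decide), hR.r2, hR.a4, arrayOf_fin] at g11
  obtain ⟨o1, o2, o3⟩ := output_insert_ver j g9 g10 g11 g6 g7 g8
  have hnot : Sum.inr j ∉ (I.output s).chosen := fun h => by
    have := (hI.ver j h).2; omega
  have hY : s.reg 80 + (I.ver j).height ≤ I.N := by
    refine Nat.le_of_mul_le_mul_left ?_ hs
    rw [mul_add]
    exact (Nat.add_le_add_right hI.pos_hor _).trans e7
  have hX : I.scale * (s.reg 81 + (I.ver j).width) ≤ s₀.arr 33 y := by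
    rw [mul_add]
    exact (Nat.add_le_add_right hI.pos_ver _).trans e5
  have hpack : (I.output (walkBody.run s)).IsLPacking := by
    refine hI.packing.insert_ver hnot o1 o2 o3 (by omega) ?_ (fun i' h => (hI.ver i' h).1) ?_
    · exact Nat.le_of_mul_le_mul_left (hX.trans e6) hs
    · intro i hi
      have := (hI.hor i hi).1
      omega
  refine ⟨⟨g1, hy, by rw [g3, e2]; exact hI.pos_hor, by rw [g2]; exact hX, hpack, ?_, ?_, ?_⟩, ?_⟩
  · intro i hi
    rw [o1, Finset.mem_insert] at hi
    have := hI.hor i (hi.resolve_left (by simp))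
    rw [e1, g3]
    refine ⟨?_, this.2⟩
    have e : (I.output (walkBody.run s)).top (Sum.inl i) = (I.output s).top (Sum.inl i) := by
      simp [Placement.top, o3]
    rw [e]; exact this.1
  · intro j' hj'
    rw [o1, Finset.mem_insert] at hj'
    rw [hj, g2]
    by_cases h : j' = j
    · subst h
      simp [Placement.right, o2, item]
    · have hj'' : Sum.inr j' ∈ (I.output s).chosen :=
        hj'.resolve_left fun h' => h (Sum.inr_injective h')
      have := hI.ver j' hj''
      refine ⟨?_, by omega⟩
      have e : (I.output (walkBody.run s)).right (Sum.inr j') =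
          (I.output s).right (Sum.inr j') := by
        simp [Placement.right, o2, h]
      rw [e]; omega
  · have : (I.output (walkBody.run s)).profit = (I.ver j).profit + (I.output s).profit := by
      rw [Placement.profit, o1, Finset.sum_insert hnot]; rfl
    have := hI.profit
    omega
  · simp only [rank, e1, hj]
    exact Nat.add_lt_add_left (card_filter_key_lt (key := fun k => I.lenV k - k) j.2 e4) _

theorem WalkInv.congr {I : Instance} {s₀ s s' : State} {w x : ℕ} (h : WalkInv I s₀ s w x)
    (h40 : s'.reg 40 = s.reg 40) (h80 : s'.reg 80 = s.reg 80) (h81 : s'.reg 81 = s.reg 81)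
    (harr : s'.arr = s.arr) : WalkInv I s₀ s' w x := by
  have ho : I.output s' = I.output s := by simp only [output, harr]
  refine ⟨by rw [h40, h.reg], h.lt, by rw [h80]; exact h.pos_hor, by rw [h81]; exact h.pos_ver,
    by rw [ho]; exact h.packing, ?_, ?_, by rw [ho]; exact h.profit⟩
  · rw [ho, h80]; exact h.hor
  · rw [ho, h81]; exact h.ver

/-- The walk outputs an L-packing with at least the profit that is recorded as the value of the
first record. It has stopped after at most `n` rounds, because each edge decreases the rank. -/
theorem walk_spec {I : Instance} {s : State} (hR : Ready I s) (h0 : 0 < s.reg 18)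
    (hS : Sound (Step s) (s.reg 18) s) :
    Runs walk s (3 + (I.scale * 36 + 2)) fun s' =>
      (I.output s').IsLPacking ∧ s.arr 34 0 ≤ (I.output s').profit := by
  refine Runs.seq (Runs.of_loopFree (Q := fun s1 => s1.arr = s.arr ∧ s1.reg 40 = 0 ∧
    s1.reg 80 = 0 ∧ s1.reg 81 = 0) (by simp [Prog.LoopFree])
    (by simp [Prog.run, State.reg_setReg, State.arr_setReg]))
    (fun s1 ⟨e1, e2, e3, e4⟩ F1 => (Runs.forP (B := 33) (m := I.scale) (fun r s' => ∃ x,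
      WalkInv I s s' (s.arr 34 0) x ∧ (s.arr 35 x = 0 ∨ rank I s x + r ≤ I.numItems))
      (by rw [F1.reg 7 (by decide), hR.r7]) (by decide) (by decide) (by decide) ?_ ?_).mono
      le_rfl ?_)
  · refine ⟨0, WalkInv.congr (s := s1) ?_ rfl rfl rfl rfl, Or.inr (rank_le I s 0)⟩
    have hch : (I.output s1).chosen = ∅ := by
      refine Finset.filter_false_of_mem ?_
      rintro (k | k) - <;> simp [e1, hR.a6, hR.a9]
    refine ⟨e2, h0, by simp [e3], by simp [e4], ⟨⟨?_, ?_, ?_⟩, ?_⟩, ?_, ?_, ?_⟩ <;> simp [hch]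
  · intro r _ s2 _ F2 ⟨x, hI, hx⟩
    have F : Frame walk s s2 := (F1.mono (by decide) (by decide)).trans
      (F2.mono (by decide) (by decide))
    refine (Runs.of_loopFree (P := walkBody) (Q := fun s3 => ∃ x,
      WalkInv I s s3 (s.arr 34 0) x ∧ (s.arr 35 x = 0 ∨ rank I s x + (r + 1) ≤ I.numItems))
      (by simp [walkBody, placeHor, placeVer, Prog.LoopFree]) ?_).mono (by decide) ?_
    · rcases hS x hI.lt with ⟨hnx, -⟩ | ⟨y, hy, p, hnx, hst, hw⟩
      · obtain ⟨a1, a2, a3, a4⟩ := walkBody_stop (s := s2)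
          (by rw [F.arr 35 (by decide), hI.reg, hnx])
        exact ⟨x, hI.congr a2 a3 a4 a1, Or.inl hnx⟩
      · have hr : rank I s x + r ≤ I.numItems := hx.resolve_left (by omega)
        rcases hst with ⟨hE, hp⟩ | ⟨hE, hp⟩
        · obtain ⟨b1, b2⟩ := walk_hor hR F hI hnx hy hE hp hw
          exact ⟨y, b1, Or.inr (by omega)⟩
        · obtain ⟨b1, b2⟩ := walk_ver hR F hI hnx hy hE hp hw
          exact ⟨y, b1, Or.inr (by omega)⟩
    · rintro s3 ⟨x, hI, hx⟩ -
      exact ⟨x, hI.congr rfl rfl rfl rfl, hx⟩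
  · rintro s' ⟨x, hI, hx⟩ -
    have hnx : s.arr 35 x = 0 := hx.resolve_right (by simp only [scale]; omega)
    refine ⟨hI.packing, ?_⟩
    rcases hS x hI.lt with ⟨-, h⟩ | ⟨y, -, p, h, -⟩
    · have := hI.profit; omega
    · omega

/-! ### The program -/

/-- Prepare the scaled numbers: the factor `n + 1` in register `7`, its square in register `13`, the
scaled side and capacities in registers `10` to `12`, and the scaled sizes in arrays `20` to `24`. -/
def prep : Prog :=
  .seq (.seq (.add 7 5 6) (.seq (.const 9 1) (.add 7 7 9)))
  (.seq (mulS 10 2 60) (.seq (mulS 11 3 60) (.seq (mulS 12 4 60) (.seq (mulS 13 7 60)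
  (.seq (scaleArr 0 20 5) (.seq (scaleArr 1 21 5) (.seq (scaleArr 4 23 6) (.seq (scaleArr 3 24 6)
  (.seq (.const 64 1) (.seq (.add 64 10 64) (.seq (.add 62 64 5) (.seq (.store 20 5 62)
    (.seq (.add 62 64 6) (.store 23 6 62))))))))))))))

/-- The number of steps of `prep`. -/
def timePrep (σ nH nV : ℕ) : ℕ :=
  3 + (4 * (σ * 4 + 3) + 2 * (nH * (σ * 4 + 8) + 2) + 2 * (nV * (σ * 4 + 8) + 2) + 6)

theorem arrayOf_of_le {n : ℕ} (f : Fin n → ℕ) {k : ℕ} (h : n ≤ k) : arrayOf f k = 0 := by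
  simp [arrayOf, not_lt.2 h]

theorem prep_spec (I : Instance) (ε : ℚ) :
    Runs prep (I.input ε) (timePrep I.scale I.numHor I.numVer) fun s =>
      Ready I s ∧ s.reg 13 = I.scale * I.scale ∧ s.reg 1 = ε.den ∧
        s.arr 34 = (fun _ => 0) ∧ s.arr 35 = fun _ => 0 := by
  refine (Runs.seq (Runs.of_loopFree (Q := fun s => s.reg 7 = I.scale ∧
    (∀ r < 7, s.reg r = (I.input ε).reg r) ∧ s.arr = (I.input ε).arr) (by simp [Prog.LoopFree]) ?_)
    (B' := (I.scale * 4 + 3) + ((I.scale * 4 + 3) + ((I.scale * 4 + 3) + ((I.scale * 4 + 3) +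
      ((I.numHor * (I.scale * 4 + 8) + 2) + ((I.numHor * (I.scale * 4 + 8) + 2) +
      ((I.numVer * (I.scale * 4 + 8) + 2) + ((I.numVer * (I.scale * 4 + 8) + 2) + 6))))))))
    ?_).mono (by simp [timePrep, Prog.cost]; omega) fun _ h _ => h
  · refine ⟨?_, ?_, ?_⟩
    · simp [Prog.run, State.reg_setReg, Instance.input, scale, numItems]
    · intro r hr
      simp only [Prog.run, State.reg_setReg]
      repeat rw [if_neg (by omega)]
    · simp [Prog.run, State.arr_setReg]
  rintro s ⟨h7, hr, ha⟩ -
  have h1 := hr 1 (by norm_num)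
  have h2 := hr 2 (by norm_num)
  have h3 := hr 3 (by norm_num)
  have h4 := hr 4 (by norm_num)
  have h5 := hr 5 (by norm_num)
  have h6 := hr 6 (by norm_num)
  simp only [Instance.input] at h1 h2 h3 h4 h5 h6
  have a0 : s.arr 0 = arrayOf fun i => (I.hor i).width := by rw [ha]; rfl
  have a1 : s.arr 1 = arrayOf fun i => (I.hor i).height := by rw [ha]; rfl
  have a2 : s.arr 2 = arrayOf fun i => (I.hor i).profit := by rw [ha]; rfl
  have a3 : s.arr 3 = arrayOf fun i => (I.ver i).width := by rw [ha]; rfl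
  have a4 : s.arr 4 = arrayOf fun i => (I.ver i).height := by rw [ha]; rfl
  have a5 : s.arr 5 = arrayOf fun i => (I.ver i).profit := by rw [ha]; rfl
  have az : ∀ a, 6 ≤ a → s.arr a = fun _ => 0 := by
    intro a h
    rw [ha]
    simp only [Instance.input]
    split <;> first | omega | rfl
  refine Runs.seq ((mulS_spec s (d := 10) (a := 2) (i := 60) (by decide) (by decide) (by decide)
    (by decide)).mono (by rw [h7]) fun _ h F => And.intro h F) fun s1 ⟨b1, F1⟩ _ => ?_
  rw [h7, h2] at b1
  refine Runs.seq ((mulS_spec s1 (d := 11) (a := 3) (i := 60) (by decide) (by decide) (by decide)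
    (by decide)).mono (by rw [F1.reg 7 (by decide), h7]) fun _ h F => And.intro h F)
    fun s2 ⟨b2, F2⟩ _ => ?_
  rw [F1.reg 7 (by decide), h7, F1.reg 3 (by decide), h3] at b2
  refine Runs.seq ((mulS_spec s2 (d := 12) (a := 4) (i := 60) (by decide) (by decide) (by decide)
    (by decide)).mono (by rw [F2.reg 7 (by decide), F1.reg 7 (by decide), h7])
    fun _ h F => And.intro h F) fun s3 ⟨b3, F3⟩ _ => ?_
  rw [F2.reg 7 (by decide), F1.reg 7 (by decide), h7, F2.reg 4 (by decide), F1.reg 4 (by decide),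
    h4] at b3
  have F13 : Frame (.seq (mulS 10 2 60) (.seq (mulS 11 3 60) (mulS 12 4 60))) s s3 :=
    ((F1.mono (by decide) (by decide)).trans (F2.mono (by decide) (by decide))).trans
      (F3.mono (by decide) (by decide))
  refine Runs.seq ((mulS_spec s3 (d := 13) (a := 7) (i := 60) (by decide) (by decide) (by decide)
    (by decide)).mono (by rw [F13.reg 7 (by decide), h7])
    fun _ h F => And.intro h F) fun s4 ⟨b4, F4⟩ _ => ?_
  rw [F13.reg 7 (by decide), h7] at b4
  have F14 : Frame (.seq (mulS 10 2 60) (.seq (mulS 11 3 60) (.seq (mulS 12 4 60)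
      (mulS 13 7 60)))) s s4 :=
    (F13.mono (by decide) (by decide)).trans (F4.mono (by decide) (by decide))
  have c7 : s4.reg 7 = I.scale := by rw [F14.reg 7 (by decide), h7]
  have c5 : s4.reg 5 = I.numHor := by rw [F14.reg 5 (by decide), h5]
  have c6 : s4.reg 6 = I.numVer := by rw [F14.reg 6 (by decide), h6]
  have ca : s4.arr = s.arr := funext fun a => F14.arr a (by
    rw [show (Prog.seq (mulS 10 2 60) (.seq (mulS 11 3 60) (.seq (mulS 12 4 60)
      (mulS 13 7 60)))).arrs = [] from rfl]; simp)
  refine Runs.seq ((scaleArr_spec (src := 0) (dst := 20) (cnt := 5) s4 (by decide) (by decide)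
    (by rw [ca]; exact az 20 (by decide))
    (fun k hk => by rw [ca, a0]; exact arrayOf_of_le _ (c5 ▸ hk))).mono
    (by rw [c5, c7]) fun _ h F => And.intro h F) fun s5 ⟨b5, F5⟩ _ => ?_
  rw [ca, c7, a0] at b5
  refine Runs.seq ((scaleArr_spec (src := 1) (dst := 21) (cnt := 5) s5 (by decide) (by decide)
    (by rw [F5.arr 21 (by decide), ca]; exact az 21 (by decide))
    (fun k hk => by
      rw [F5.reg 5 (by decide), c5] at hk
      rw [F5.arr 1 (by decide), ca, a1]; exact arrayOf_of_le _ hk)).mono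
    (by rw [F5.reg 5 (by decide), F5.reg 7 (by decide), c5, c7]) fun _ h F => And.intro h F)
    fun s6 ⟨b6, F6⟩ _ => ?_
  rw [F5.reg 7 (by decide), F5.arr 1 (by decide), ca, c7, a1] at b6
  have F56 : Frame (.seq (scaleArr 0 20 5) (scaleArr 1 21 5)) s4 s6 :=
    (F5.mono (by decide) (by decide)).trans (F6.mono (by decide) (by decide))
  refine Runs.seq ((scaleArr_spec (src := 4) (dst := 23) (cnt := 6) s6 (by decide) (by decide)
    (by rw [F56.arr 23 (by decide), ca]; exact az 23 (by decide))
    (fun k hk => by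
      rw [F56.reg 6 (by decide), c6] at hk
      rw [F56.arr 4 (by decide), ca, a4]; exact arrayOf_of_le _ hk)).mono
    (by rw [F56.reg 6 (by decide), F56.reg 7 (by decide), c6, c7]) fun _ h F => And.intro h F)
    fun s7 ⟨b7, F7⟩ _ => ?_
  rw [F56.reg 7 (by decide), F56.arr 4 (by decide), ca, c7, a4] at b7
  have F57 : Frame (.seq (scaleArr 0 20 5) (.seq (scaleArr 1 21 5) (scaleArr 4 23 6))) s4 s7 :=
    (F56.mono (by decide) (by decide)).trans (F7.mono (by decide) (by decide))
  refine Runs.seq ((scaleArr_spec (src := 3) (dst := 24) (cnt := 6) s7 (by decide) (by decide)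
    (by rw [F57.arr 24 (by decide), ca]; exact az 24 (by decide))
    (fun k hk => by
      rw [F57.reg 6 (by decide), c6] at hk
      rw [F57.arr 3 (by decide), ca, a3]; exact arrayOf_of_le _ hk)).mono
    (by rw [F57.reg 6 (by decide), F57.reg 7 (by decide), c6, c7]) fun _ h F => And.intro h F)
    fun s8 ⟨b8, F8⟩ _ => ?_
  rw [F57.reg 7 (by decide), F57.arr 3 (by decide), ca, c7, a3] at b8
  have F58 : Frame (.seq (scaleArr 0 20 5) (.seq (scaleArr 1 21 5) (.seq (scaleArr 4 23 6)
      (scaleArr 3 24 6)))) s4 s8 :=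
    (F57.mono (by decide) (by decide)).trans (F8.mono (by decide) (by decide))
  have d10 : s8.reg 10 = I.scale * I.N := by
    rw [F58.reg 10 (by decide), F4.reg 10 (by decide), F3.reg 10 (by decide),
      F2.reg 10 (by decide), b1]
  have d5 : s8.reg 5 = I.numHor := by rw [F58.reg 5 (by decide), c5]
  have d6 : s8.reg 6 = I.numVer := by rw [F58.reg 6 (by decide), c6]
  have d20 : s8.arr 20 = fun k => I.scale * arrayOf (fun i => (I.hor i).width) k := by
    rw [F8.arr 20 (by decide), F7.arr 20 (by decide), F6.arr 20 (by decide), b5]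
  have d23 : s8.arr 23 = fun k => I.scale * arrayOf (fun i => (I.ver i).height) k := by
    rw [F8.arr 23 (by decide), b7]
  refine (Runs.of_loopFree (P := .seq (.const 64 1) (.seq (.add 64 10 64) (.seq (.add 62 64 5)
    (.seq (.store 20 5 62) (.seq (.add 62 64 6) (.store 23 6 62))))))
    (Q := fun s9 => s9.arr 20 = I.lenH ∧ s9.arr 23 = I.lenV) (by simp [Prog.LoopFree]) ?_).mono
    le_rfl ?_
  · simp [Prog.run, State.reg_setReg, State.arr_setReg, State.reg_setArr, State.arr_setArr,
      d10, d5, d6, d20, d23, lenH, lenV]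
  · rintro s9 ⟨b20, b23⟩ F9
    have F49 : Frame (.seq (.seq (scaleArr 0 20 5) (.seq (scaleArr 1 21 5)
        (.seq (scaleArr 4 23 6) (scaleArr 3 24 6)))) (.seq (.const 64 1) (.seq (.add 64 10 64)
        (.seq (.add 62 64 5) (.seq (.store 20 5 62) (.seq (.add 62 64 6)
          (.store 23 6 62))))))) s4 s9 :=
      (F58.mono (by decide) (by decide)).trans (F9.mono (by decide) (by decide))
    refine ⟨⟨?_, ?_, ?_, ?_, ?_, ?_, ?_, ?_, ?_, ?_, ?_, ?_, ?_, ?_, ?_, b20, ?_, b23, ?_⟩,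
      ?_, ?_, ?_, ?_⟩
    · rw [F49.reg 2 (by decide), F14.reg 2 (by decide), h2]
    · rw [F49.reg 5 (by decide), c5]
    · rw [F49.reg 6 (by decide), c6]
    · rw [F49.reg 7 (by decide), c7]
    · rw [F9.reg 10 (by decide), d10]
    · rw [F49.reg 11 (by decide), F4.reg 11 (by decide), F3.reg 11 (by decide), b2]
    · rw [F49.reg 12 (by decide), F4.reg 12 (by decide), b3]
    · rw [F49.arr 0 (by decide), ca, a0]
    · rw [F49.arr 1 (by decide), ca, a1]
    · rw [F49.arr 2 (by decide), ca, a2]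
    · rw [F49.arr 3 (by decide), ca, a3]
    · rw [F49.arr 4 (by decide), ca, a4]
    · rw [F49.arr 5 (by decide), ca, a5]
    · rw [F49.arr 6 (by decide), ca, az 6 (by decide)]
    · rw [F49.arr 9 (by decide), ca, az 9 (by decide)]
    · rw [F9.arr 21 (by decide), F8.arr 21 (by decide), F7.arr 21 (by decide), b6]
    · rw [F9.arr 24 (by decide), b8]
    · rw [F49.reg 13 (by decide), b4]
    · rw [F49.reg 1 (by decide), F14.reg 1 (by decide), h1]
    · rw [F49.arr 34 (by decide), ca, az 34 (by decide)]
    · rw [F49.arr 35 (by decide), ca, az 35 (by decide)]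

theorem Instance.Ready.of_frame {I : Instance} {P : Prog} {s s' : State} (h : Ready I s)
    (hF : Frame P s s') (hr : ∀ r ∈ [2, 5, 6, 7, 10, 11, 12], r ∉ P.regs)
    (ha : ∀ a ∈ [0, 1, 2, 3, 4, 5, 6, 9, 20, 21, 23, 24], a ∉ P.arrs) : Ready I s' := by
  simp only [List.forall_mem_cons] at hr ha
  obtain ⟨r2, r5, r6, r7, r10, r11, r12, -⟩ := hr
  obtain ⟨a0, a1, a2, a3, a4, a5, a6, a9, a20, a21, a23, a24, -⟩ := ha
  exact ⟨by rw [hF.reg _ r2, h.r2], by rw [hF.reg _ r5, h.r5], by rw [hF.reg _ r6, h.r6],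
    by rw [hF.reg _ r7, h.r7], by rw [hF.reg _ r10, h.r10], by rw [hF.reg _ r11, h.r11],
    by rw [hF.reg _ r12, h.r12], by rw [hF.arr _ a0, h.a0], by rw [hF.arr _ a1, h.a1],
    by rw [hF.arr _ a2, h.a2], by rw [hF.arr _ a3, h.a3], by rw [hF.arr _ a4, h.a4],
    by rw [hF.arr _ a5, h.a5], by rw [hF.arr _ a6, h.a6], by rw [hF.arr _ a9, h.a9],
    by rw [hF.arr _ a20, h.a20], by rw [hF.arr _ a21, h.a21], by rw [hF.arr _ a23, h.a23],
    by rw [hF.arr _ a24, h.a24]⟩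

/-- The rounded positions for the horizontal items. -/
def posH (I : Instance) (r : ℕ) : ℕ → Prop :=
  RPos I.scale (arrayOf fun i => (I.hor i).height) I.numHor r

/-- The rounded positions for the vertical items. -/
def posV (I : Instance) (r : ℕ) : ℕ → Prop :=
  RPos I.scale (arrayOf fun j => (I.ver j).width) I.numVer r

/-- Sequences of items that can be appended to a partial packing with record `(i, j, t, l)`, such
that all records on the way have positions in `posH` and `posV`, with the number of items
and the total profit. -/
inductive Chain (I : Instance) (r : ℕ) : ℕ → ℕ → ℕ → ℕ → ℕ → ℕ → Prop
  | nil (i j t l : ℕ) : Chain I r i j t l 0 0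
  | hor {i j t l i' t' n q : ℕ} :
      Edge I.lenH (fun k => I.scale * arrayOf (fun i => (I.hor i).height) k) I.numHor
        (I.scale * I.hL) (I.scale * I.N) i j t l i' j t' l →
      posH I r t' → Chain I r i' j t' l n q →
      Chain I r i j t l (n + 1) (arrayOf (fun i => (I.hor i).profit) i' + q)
  | ver {i j t l j' l' n q : ℕ} :
      Edge I.lenV (fun k => I.scale * arrayOf (fun j => (I.ver j).width) k) I.numVer
        (I.scale * I.wL) (I.scale * I.N) j i l t j' i l' t →
      posV I r l' → Chain I r i j' t l' n q →
      Chain I r i j t l (n + 1) (arrayOf (fun j => (I.ver j).profit) j' + q)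

/-- A chain is a path in the graph of the listed records. -/
theorem Chain.path {I : Instance} {r : ℕ} {s : State} (hR : Ready I s)
    (hrec : ∀ i ≤ I.numHor, ∀ j ≤ I.numVer, ∀ t l, posH I r t → posV I r l → HasRec s i j t l)
    {i j t l n q : ℕ} (h : Chain I r i j t l n q) (hi : i ≤ I.numHor) (hj : j ≤ I.numVer)
    (ht : posH I r t) (hl : posV I r l) {x : ℕ} (hx : IsRec s x i j t l) :
    Path (Step s) (s.reg 18) x n q := by
  induction h generalizing x with
  | nil i j t l => exact Path.nil x
  | @hor i j t l i' t' n q hE ht' _ ih =>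
    obtain ⟨y, hy, hrec'⟩ := hrec i' hE.lt.le j hj t' l ht' hl
    refine Path.cons (Or.inl ⟨?_, ?_⟩) hy (ih hE.lt.le hj ht' hl hrec')
    · rw [EdgeH, hx.1, hx.2.1, hx.2.2.1, hx.2.2.2, hrec'.1, hrec'.2.1, hrec'.2.2.1, hrec'.2.2.2,
        hR.a20, hR.a21, hR.r5, hR.r12, hR.r10]
      exact hE
    · rw [hrec'.1, hR.a2]
  | @ver i j t l j' l' n q hE hl' _ ih =>
    obtain ⟨y, hy, hrec'⟩ := hrec i hi j' hE.lt.le t l' ht hl'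
    refine Path.cons (Or.inr ⟨?_, ?_⟩) hy (ih hi hE.lt.le ht hl' hrec')
    · rw [EdgeV, hx.1, hx.2.1, hx.2.2.1, hx.2.2.2, hrec'.1, hrec'.2.1, hrec'.2.2.1, hrec'.2.2.2,
        hR.a23, hR.a24, hR.r6, hR.r11, hR.r10]
      exact hE
    · rw [hrec'.2.1, hR.a5]

/-- The approximation scheme. -/
def scheme : Prog :=
  .seq prep (.seq (buildT 1 21 26 14 5) (.seq (buildT 3 24 27 15 6) (.seq buildK
    (.seq bellmanFord walk))))

/-- The number of records, for scaling factor `σ`. -/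
def numRec (σ nH nV d : ℕ) : ℕ :=
  1 + (nH + 1) * ((nV + 1) * (numPos σ nH d * numPos σ nV d))

/-- A bound for the number of steps of `scheme`, for scaling factor `σ` and denominator `d` of the
accuracy. -/
def timeScheme (σ nH nV d : ℕ) : ℕ :=
  timePrep σ nH nV + (timePos σ nH d + (timePos σ nV d +
    (timeRec nH nV (numPos σ nH d) (numPos σ nV d) +
    (timeBF σ (numRec σ nH nV d) + (3 + (σ * 36 + 2))))))

theorem RPos.zero (s : ℕ) (h : ℕ → ℕ) (m r : ℕ) : RPos s h m r 0 := by
  induction r with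
  | zero => exact Or.inl rfl
  | succ r ih => exact Or.inl ih

/-- The program outputs an L-packing whose profit is at least that of every chain from the start
record. -/
theorem scheme_spec (I : Instance) (ε : ℚ) :
    Runs scheme (I.input ε) (timeScheme I.scale I.numHor I.numVer ε.den) fun s =>
      (I.output s).IsLPacking ∧ ∀ n ≤ I.scale, ∀ q,
        Chain I ε.den I.numHor I.numVer 0 0 n q → q ≤ (I.output s).profit := by
  refine Runs.seq (prep_spec I ε) fun s1 ⟨hR1, h13, h1, h34, h35⟩ _ => ?_
  refine Runs.seq ((buildT_spec (by decide) (by decide) (Or.inl rfl) (by decide) s1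
    (σ := I.scale) h13 (fun i => by rw [hR1.a21, hR1.a1])).mono (by rw [hR1.r5, h1])
    fun _ h F => And.intro h F) fun s2 ⟨⟨g1, g2⟩, F2⟩ _ => ?_
  rw [hR1.r5, h1] at g1
  rw [hR1.r5, h1, hR1.a1] at g2
  have hR2 : Ready I s2 := hR1.of_frame F2 (by decide) (by decide)
  have h1' : s2.reg 1 = ε.den := by rw [F2.reg 1 (by decide), h1]
  refine Runs.seq ((buildT_spec (by decide) (by decide) (Or.inr rfl) (by decide) s2
    (σ := I.scale) (by rw [F2.reg 13 (by decide), h13])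
    (fun i => by rw [hR2.a24, hR2.a3])).mono (by rw [hR2.r6, h1'])
    fun _ h F => And.intro h F) fun s3 ⟨⟨g3, g4⟩, F3⟩ _ => ?_
  rw [hR2.r6, h1'] at g3
  rw [hR2.r6, h1', hR2.a3] at g4
  have hR3 : Ready I s3 := hR2.of_frame F3 (by decide) (by decide)
  have e14 : s3.reg 14 = numPos I.scale I.numHor ε.den := by rw [F3.reg 14 (by decide), g1]
  refine Runs.seq ((buildK_spec s3).mono (by rw [hR3.r5, hR3.r6, e14, g3])
    fun _ h F => And.intro h F) fun s4 ⟨⟨k1, k2, k3⟩, F4⟩ _ => ?_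
  rw [hR3.r5, hR3.r6, e14, g3] at k1
  change s4.reg 18 = numRec I.scale I.numHor I.numVer ε.den at k1
  rw [hR3.r5, hR3.r6] at k2 k3
  have hR4 : Ready I s4 := hR3.of_frame F4 (by decide) (by decide)
  refine Runs.seq ((bellmanFord_spec s4
    (by rw [F4.arr 34 (by decide), F3.arr 34 (by decide), F2.arr 34 (by decide), h34])
    (by rw [F4.arr 35 (by decide), F3.arr 35 (by decide), F2.arr 35 (by decide), h35])).mono
    (by rw [hR4.r7, k1]) fun _ h F => And.intro h F) fun s5 ⟨⟨m1, m2⟩, F5⟩ _ => ?_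
  have hR5 : Ready I s5 := hR4.of_frame F5 (by decide) (by decide)
  have e18 : s5.reg 18 = s4.reg 18 := F5.reg 18 (by decide)
  have hpos : 0 < s4.reg 18 := by rw [k1, numRec]; omega
  refine (walk_spec hR5 (by rw [e18]; exact hpos)
    (by rw [step_of_frame F5 (by decide) (by decide), e18]; exact m1)).mono le_rfl ?_
  rintro s6 ⟨w1, w2⟩ -
  refine ⟨w1, fun n hn q hq => le_trans ?_ w2⟩
  refine m2 0 hpos n (by rw [hR4.r7]; exact hn) q ?_
  refine hq.path hR4 (fun i hi j hj t l ht hl => k3 i hi j hj t l ?_ (g4 l hl)) le_rfl le_rfl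
    (RPos.zero _ _ _ _) (RPos.zero _ _ _ _) k2
  obtain ⟨k, hk, hk'⟩ := g2 t ht
  exact ⟨k, by rw [F3.reg 14 (by decide)]; exact hk, by rw [F3.arr 26 (by decide)]; exact hk'⟩

/-! ### The running time is polynomial -/

/-- The function is bounded by a polynomial. -/
def PolyBdd (f : ℕ → ℕ) : Prop := ∃ c, ∀ n, f n ≤ c * (n + 1) ^ c

theorem PolyBdd.const (a : ℕ) : PolyBdd fun _ => a :=
  ⟨a, fun n => Nat.le_mul_of_pos_right a (by positivity)⟩

theorem PolyBdd.id : PolyBdd fun n => n := ⟨1, fun n => by simp⟩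

theorem PolyBdd.add {f g : ℕ → ℕ} (hf : PolyBdd f) (hg : PolyBdd g) :
    PolyBdd fun n => f n + g n := by
  obtain ⟨a, ha⟩ := hf
  obtain ⟨b, hb⟩ := hg
  refine ⟨a + b, fun n => (Nat.add_le_add (ha n) (hb n)).trans ?_⟩
  rw [add_mul]
  gcongr <;> omega

theorem PolyBdd.mul {f g : ℕ → ℕ} (hf : PolyBdd f) (hg : PolyBdd g) :
    PolyBdd fun n => f n * g n := by
  obtain ⟨a, ha⟩ := hf
  obtain ⟨b, hb⟩ := hg
  refine ⟨a * b + (a + b), fun n => (Nat.mul_le_mul (ha n) (hb n)).trans ?_⟩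
  calc a * (n + 1) ^ a * (b * (n + 1) ^ b) = a * b * (n + 1) ^ (a + b) := by ring
    _ ≤ (a * b + (a + b)) * (n + 1) ^ (a * b + (a + b)) :=
        Nat.mul_le_mul (by omega) (Nat.pow_le_pow_right (by omega) (by omega))

theorem PolyBdd.pow {f : ℕ → ℕ} (hf : PolyBdd f) (d : ℕ) : PolyBdd fun n => f n ^ d := by
  induction d with
  | zero => simpa using PolyBdd.const 1
  | succ d ih => simpa only [pow_succ] using ih.mul hf

theorem timeScheme_mono {σ nH nV n d : ℕ} (hH : nH ≤ n) (hV : nV ≤ n) :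
    timeScheme σ nH nV d ≤ timeScheme σ n n d := by
  unfold timeScheme timePrep timePos timeRec timeBF numRec numPos
  gcongr

theorem polyBdd_timeScheme (d : ℕ) : PolyBdd fun n => timeScheme (n + 1) n n d := by
  unfold timeScheme timePrep timePos timeRec timeBF numRec numPos
  repeat' first
    | with_reducible exact PolyBdd.const _
    | with_reducible exact PolyBdd.id
    | with_reducible refine PolyBdd.add ?_ ?_
    | with_reducible refine PolyBdd.mul ?_ ?_
    | with_reducible refine PolyBdd.pow ?_ _

/-! ### Rounding a sequence of partial sums -/

/-- A multiple of `d` between `x` and `x + d`, if `d` is positive. -/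
def roundUp (d x : ℕ) : ℕ := (x + d) / d * d

theorem le_roundUp {d x : ℕ} (h : d = 0 → x = 0) : x ≤ roundUp d x := by
  rcases Nat.eq_zero_or_pos d with hd | hd
  · rw [h hd]; exact Nat.zero_le _
  · have := Nat.lt_div_mul_add (a := x + d) hd
    rw [roundUp]; omega

theorem roundUp_le (d x : ℕ) : roundUp d x ≤ x + d := Nat.div_mul_le_self _ _

theorem RPos.add_sum {s : ℕ} {h : ℕ → ℕ} {m u : ℕ} {ι : Type*} (S : Finset ι) (v : ι → ℕ)
    (hu : RPos s h m 0 u) (hv : ∀ c ∈ S, v c = 0 ∨ ∃ i < m, v c = h i) :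
    RPos s h m S.card (u + s * ∑ c ∈ S, v c) := by
  classical
  induction S using Finset.induction_on with
  | empty => simpa using hu
  | insert c S hc ih =>
    have ih' := ih fun c' hc' => hv c' (Finset.mem_insert_of_mem hc')
    rw [Finset.card_insert_of_notMem hc, Finset.sum_insert hc]
    rcases hv c (Finset.mem_insert_self c S) with h0 | ⟨i, hi, h0⟩
    · rw [h0, zero_add]; exact Or.inl ih'
    · exact Or.inr ⟨_, ih', i, hi, by rw [h0]; ring⟩

theorem sum_update_add {ι : Type*} [Fintype ι] [DecidableEq ι] (v : ι → ℕ) (c : ι) (x : ℕ) :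
    ∑ i, Function.update v c x i + v c = ∑ i, v i + x := by
  rw [Finset.sum_update_of_mem (Finset.mem_univ c),
    ← Finset.add_sum_erase Finset.univ v (Finset.mem_univ c), Finset.sdiff_singleton_eq_erase]
  ring

/-- A colouring of the items of a sequence such that the `r + 1` largest items of every initial
segment have different colours: the slot of a colour holds the size of the item of this colour
among these (`0` if there is none, which happens only for short segments). An item that is larger than the
smallest slot replaces it and gets its colour; other items get no colour. -/
theorem exists_colouring (r : ℕ) (h : ℕ → ℕ) : ∃ (v : ℕ → Fin (r + 1) → ℕ)
    (col : ℕ → Option (Fin (r + 1))), (∀ c, v 0 c = 0) ∧ ∀ a,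
      (col a = none ∧ v (a + 1) = v a ∧ ∀ c, h a ≤ v a c) ∨
      ∃ c, col a = some c ∧ v (a + 1) = Function.update (v a) c (h a) ∧ v a c < h a ∧
        ∀ c', v a c ≤ v a c' := by
  have hmin : ∀ v : Fin (r + 1) → ℕ, ∃ c, ∀ c', v c ≤ v c' := fun v => Finite.exists_min v
  choose mn hmn using hmin
  let nxt : ℕ → (Fin (r + 1) → ℕ) → (Fin (r + 1) → ℕ) := fun a v =>
    if v (mn v) < h a then Function.update v (mn v) (h a) else v
  let v : ℕ → Fin (r + 1) → ℕ := fun a =>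
    Nat.rec (motive := fun _ => Fin (r + 1) → ℕ) (fun _ => 0) nxt a
  let col : ℕ → Option (Fin (r + 1)) := fun a =>
    if v a (mn (v a)) < h a then some (mn (v a)) else none
  refine ⟨v, col, fun _ => rfl, ?_⟩
  intro a
  have hv : v (a + 1) = nxt a (v a) := rfl
  by_cases hlt : v a (mn (v a)) < h a
  · right
    exact ⟨mn (v a), if_pos hlt, by rw [hv]; exact if_pos hlt, hlt, hmn (v a)⟩
  · left
    exact ⟨if_neg hlt, by rw [hv]; exact if_neg hlt, fun c => (not_lt.1 hlt).trans (hmn (v a) c)⟩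

/-- After the items of one of `r + 1` colours have been deleted, the partial sums (scaled by `s`)
can be replaced by positions from a small set: the `r` largest remaining items are
counted exactly, and the total size of the others, none of which exceeds the current slot `d` of
the deleted colour, is rounded up to a multiple of `d`. All roundings together cost at most `s * d`,
which is what the deletion has gained. -/
theorem exists_rounding {s k r m : ℕ} (H h p : ℕ → ℕ) (hk : k < s)
    (hH : ∀ a < k, ∃ i < m, h a = H i) :
    ∃ (del : ℕ → Bool) (τ : ℕ → ℕ), (∀ a ≤ k, RPos s H m r (τ a)) ∧
      (∀ a ≤ k, τ a ≤ s * ∑ i ∈ Finset.range a, h i) ∧ (∀ a < k, τ a ≤ τ (a + 1)) ∧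
      (∀ a < k, del a = false → τ a + s * h a ≤ τ (a + 1)) ∧
      (r + 1) * ∑ a ∈ Finset.range k, p a ≤
        (r + 1) * (∑ a ∈ Finset.range k, if del a then 0 else p a) +
          ∑ a ∈ Finset.range k, p a := by
  classical
  obtain ⟨v, col, hv0, hv⟩ := exists_colouring r h
  -- the colour of least total profit
  obtain ⟨c₀, -, hc₀⟩ := Finset.exists_le_of_sum_le (s := (Finset.univ : Finset (Fin (r + 1))))
    (f := fun c => (r + 1) * ∑ a ∈ Finset.range k, if col a = some c then p a else 0)
    (g := fun _ => ∑ a ∈ Finset.range k, p a) Finset.univ_nonempty (by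
      rw [← Finset.mul_sum, Finset.sum_comm, Finset.sum_const, Finset.card_univ, Fintype.card_fin,
        smul_eq_mul]
      refine Nat.mul_le_mul_left _ (Finset.sum_le_sum fun a _ => ?_)
      cases hc : col a with
      | none => simp
      | some c => simp)
  -- `z a` is the amount that step `a` adds to the part that is rounded
  let z : ℕ → ℕ := fun a => (col a).elim (h a) fun c => if c = c₀ then 0 else v a c
  let X : ℕ → ℕ := fun a => Nat.rec 0 (fun a x => roundUp (v (a + 1) c₀) (x + s * z a)) a
  let E : ℕ → ℕ := fun a => ∑ c ∈ Finset.univ.erase c₀, v a c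
  have hX : ∀ a, X (a + 1) = roundUp (v (a + 1) c₀) (X a + s * z a) := fun _ => rfl
  have hE : ∀ a, v a c₀ + E a = ∑ c, v a c := fun a =>
    Finset.add_sum_erase _ _ (Finset.mem_univ c₀)
  have hXd : ∀ a, ∃ q, X a = q * v a c₀ := by
    rintro (_ | a)
    · exact ⟨0, (zero_mul _).symm⟩
    · exact ⟨_, hX a⟩
  have hz : ∀ a, z a ≤ v a c₀ ∧ v a c₀ ≤ v (a + 1) c₀ ∧
      ((col a = some c₀ ∧ z a = 0 ∧ E (a + 1) = E a ∧ v (a + 1) c₀ = h a) ∨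
        (col a ≠ some c₀ ∧ E (a + 1) + z a = E a + h a ∧ v (a + 1) c₀ = v a c₀)) := by
    intro a
    rcases hv a with ⟨h1, h2, h3⟩ | ⟨c, h1, h2, h3, h4⟩
    · have hza : z a = h a := by simp only [z, h1, Option.elim]
      refine ⟨by rw [hza]; exact h3 c₀, by rw [h2], Or.inr ⟨by rw [h1]; simp, ?_, by rw [h2]⟩⟩
      simp only [E, h2, hza]
    · have hsum := sum_update_add (v a) c (h a)
      rw [← h2, ← hE, ← hE] at hsum
      by_cases hc : c = c₀
      · subst hc
        have e : v (a + 1) c = h a := by rw [h2, Function.update_self]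
        have hza : z a = 0 := by simp only [z, h1, Option.elim, if_true]
        exact ⟨by omega, by omega, Or.inl ⟨h1, hza, by omega, e⟩⟩
      · have e : v (a + 1) c₀ = v a c₀ := by rw [h2, Function.update_of_ne (Ne.symm hc)]
        have hza : z a = v a c := by simp only [z, h1, Option.elim, if_neg hc]
        refine ⟨by rw [hza]; exact h4 c₀, e.ge, Or.inr ⟨?_, by omega, e⟩⟩
        rw [h1]
        exact fun h => hc (Option.some_injective _ h)
  have hXz : ∀ a, X a + s * z a ≤ X (a + 1) := by
    intro a
    rw [hX]
    refine le_roundUp fun h0 => ?_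
    obtain ⟨q, hq⟩ := hXd a
    have h1 : v a c₀ = 0 := by have := (hz a).2.1; omega
    have h2 : z a = 0 := by have := (hz a).1; omega
    rw [hq, h1, h2, mul_zero, mul_zero, add_zero]
  -- `Y` is the exact size of the part that is rounded, `D` the size of the deleted items
  have hinv : ∀ a, ∃ Y D, Y ≤ a * v a c₀ ∧ X a ≤ s * Y + a * v a c₀ ∧
      E a + Y + D = ∑ i ∈ Finset.range a, h i ∧ v a c₀ ≤ D := by
    intro a
    induction a with
    | zero => exact ⟨0, 0, by simp, by simp [X], by simp [E, hv0], by simp [hv0]⟩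
    | succ a ih =>
      obtain ⟨Y, D, i1, i2, i3, i4⟩ := ih
      obtain ⟨z1, z2, z3⟩ := hz a
      have hup : X (a + 1) ≤ X a + s * z a + v (a + 1) c₀ := roundUp_le _ _
      have hmul : a * v a c₀ ≤ a * v (a + 1) c₀ := Nat.mul_le_mul_left a z2
      have hY : Y + z a ≤ (a + 1) * v (a + 1) c₀ := by rw [Nat.succ_mul]; omega
      have hX' : X (a + 1) ≤ s * (Y + z a) + (a + 1) * v (a + 1) c₀ := by
        rw [Nat.succ_mul, mul_add]; omega
      rw [Finset.sum_range_succ]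
      rcases z3 with ⟨-, y1, y2, y3⟩ | ⟨-, y2, y3⟩
      · exact ⟨Y + z a, D + h a, hY, hX', by omega, by omega⟩
      · exact ⟨Y + z a, D, hY, hX', by omega, by omega⟩
  have hslot : ∀ a ≤ k, ∀ c, v a c = 0 ∨ ∃ i < m, v a c = H i := by
    intro a
    induction a with
    | zero => exact fun _ c => Or.inl (hv0 c)
    | succ a ih =>
      intro ha c
      rcases hv a with ⟨-, h2, -⟩ | ⟨c', -, h2, -, -⟩
      · rw [h2]; exact ih (by omega) c
      · rw [h2, Function.update_apply]
        split_ifs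
        · exact Or.inr (hH a (by omega))
        · exact ih (by omega) c
  refine ⟨fun a => decide (col a = some c₀), fun a => X a + s * E a, ?_, ?_, ?_, ?_, ?_⟩
  · intro a ha
    have hcard : (Finset.univ.erase c₀).card = r := by
      rw [Finset.card_erase_of_mem (Finset.mem_univ _), Finset.card_univ, Fintype.card_fin]; rfl
    have := RPos.add_sum (s := s) (h := H) (m := m) (u := X a) (Finset.univ.erase c₀) (v a) ?_
      fun c _ => hslot a ha c
    · rwa [hcard] at this
    · rcases hslot a ha c₀ with h0 | ⟨i, hi, h0⟩
      · obtain ⟨q, hq⟩ := hXd a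
        exact Or.inl (by rw [hq, h0, mul_zero])
      · rcases Nat.eq_zero_or_pos (v a c₀) with hd | hd
        · obtain ⟨q, hq⟩ := hXd a
          exact Or.inl (by rw [hq, hd, mul_zero])
        · obtain ⟨q, hq⟩ := hXd a
          obtain ⟨Y, D, i1, i2, -, -⟩ := hinv a
          refine Or.inr ⟨i, hi, q, ?_, by rw [hq, h0]⟩
          refine Nat.le_of_mul_le_mul_right (c := v a c₀) ?_ hd
          rw [← hq]
          have e1 : s * Y ≤ s * (a * v a c₀) := Nat.mul_le_mul_left s i1
          have e2 : (s * a + a) * v a c₀ ≤ s * s * v a c₀ := by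
            refine Nat.mul_le_mul_right _ ?_
            calc s * a + a ≤ s * a + s := by omega
              _ = s * (a + 1) := by ring
              _ ≤ s * s := Nat.mul_le_mul_left s (by omega)
          calc X a ≤ s * (a * v a c₀) + a * v a c₀ := i2.trans (Nat.add_le_add_right e1 _)
            _ = (s * a + a) * v a c₀ := by ring
            _ ≤ _ := e2
  · intro a ha
    obtain ⟨Y, D, -, i2, i3, i4⟩ := hinv a
    have e1 : a * v a c₀ ≤ s * D := Nat.mul_le_mul (by omega) i4
    calc X a + s * E a ≤ s * Y + s * D + s * E a := by omega
      _ = s * (E a + Y + D) := by ring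
      _ = _ := by rw [i3]
  · intro a _
    have := hXz a
    rcases (hz a).2.2 with ⟨-, -, y2, -⟩ | ⟨-, y2, -⟩
    · simp only [y2]; omega
    · have e : s * E a ≤ s * E (a + 1) + s * z a := by
        rw [← mul_add, y2]; exact Nat.mul_le_mul_left s (by omega)
      simp only; omega
  · intro a _ hdel
    have := hXz a
    rcases (hz a).2.2 with ⟨y1, -⟩ | ⟨-, y2, -⟩
    · simp [y1] at hdel
    · have e : s * E (a + 1) + s * z a = s * E a + s * h a := by rw [← mul_add, y2, mul_add]
      simp only; omega
  · have e : ∑ a ∈ Finset.range k, p a =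
        (∑ a ∈ Finset.range k, if decide (col a = some c₀) = true then 0 else p a) +
          ∑ a ∈ Finset.range k, if col a = some c₀ then p a else 0 := by
      rw [← Finset.sum_add_distrib]
      refine Finset.sum_congr rfl fun a _ => ?_
      by_cases hc : col a = some c₀ <;> simp [hc]
    calc (r + 1) * ∑ a ∈ Finset.range k, p a = _ := by rw [e, mul_add]
      _ ≤ _ := Nat.add_le_add_left hc₀ _

/-! ### Sorted L-packings -/

/-- Pairwise disjoint intervals below `B` have total length at most `B`. -/
theorem sum_le_of_disjoint {ι : Type*} (S : Finset ι) (y h : ι → ℕ) (B : ℕ)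
    (hB : ∀ i ∈ S, y i + h i ≤ B)
    (hd : ∀ i ∈ S, ∀ j ∈ S, i ≠ j → y i + h i ≤ y j ∨ y j + h j ≤ y i) :
    ∑ i ∈ S, h i ≤ B := by
  classical
  have hcard : (S.biUnion fun i => Finset.Ico (y i) (y i + h i)).card = ∑ i ∈ S, h i := by
    rw [Finset.card_biUnion]
    · simp
    · intro i hi j hj hij
      rw [Function.onFun, Finset.disjoint_left]
      intro x hx hx'
      rw [Finset.mem_Ico] at hx hx'
      rcases hd i hi j hj hij with h | h <;> omega
  rw [← hcard]
  refine (Finset.card_le_card (t := Finset.range B) ?_).trans (Finset.card_range B).le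
  intro x hx
  obtain ⟨i, hi, hx⟩ := Finset.mem_biUnion.1 hx
  have := hB i hi
  rw [Finset.mem_Ico] at hx
  rw [Finset.mem_range]
  omega

theorem exists_sorted (key : ℕ → ℕ) (A : Finset ℕ)
    (hinj : ∀ a ∈ A, ∀ b ∈ A, key a = key b → a = b) :
    ∃ f : ℕ → ℕ, (∀ a < A.card, f a ∈ A) ∧
      (∀ a b, a < b → b < A.card → key (f b) < key (f a)) ∧
      ∀ g : ℕ → ℕ, ∑ a ∈ Finset.range A.card, g (f a) = ∑ i ∈ A, g i := by
  induction A using Finset.induction_on_min_value key with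
  | empty => exact ⟨id, by simp⟩
  | insert a S ha hmin ih =>
    obtain ⟨f, h1, h2, h3⟩ := ih fun x hx y hy =>
      hinj x (Finset.mem_insert_of_mem hx) y (Finset.mem_insert_of_mem hy)
    rw [Finset.card_insert_of_notMem ha]
    refine ⟨Function.update f S.card a, ?_, ?_, ?_⟩
    · intro b hb
      rcases Nat.lt_succ_iff_lt_or_eq.1 hb with hb | rfl
      · rw [Function.update_of_ne hb.ne]; exact Finset.mem_insert_of_mem (h1 b hb)
      · rw [Function.update_self]; exact Finset.mem_insert_self _ _
    · intro b c hbc hc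
      rw [Function.update_of_ne (show b ≠ S.card by omega)]
      rcases Nat.lt_succ_iff_lt_or_eq.1 hc with hc | rfl
      · rw [Function.update_of_ne hc.ne]; exact h2 b c hbc hc
      · rw [Function.update_self]
        refine lt_of_le_of_ne (hmin _ (h1 b hbc)) fun he => ha ?_
        rw [hinj a (Finset.mem_insert_self _ _) (f b) (Finset.mem_insert_of_mem (h1 b hbc)) he]
        exact h1 b hbc
    · intro g
      rw [Finset.sum_range_succ, Finset.sum_insert ha, Function.update_self, ← h3 g, add_comm]
      congr 1
      refine Finset.sum_congr rfl fun b hb => ?_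
      rw [Function.update_of_ne (Finset.mem_range.1 hb).ne]

/-- The key `σ * w i - i` orders the items by decreasing length `w`, and equal lengths by
increasing index. -/
theorem key_le {σ a b i j : ℕ} (hj : j < σ) (h : σ * b - j ≤ σ * a - i) : b ≤ a := by
  by_contra hlt
  have h1 : σ * (a + 1) ≤ σ * b := Nat.mul_le_mul_left σ (by omega)
  rw [mul_add, mul_one] at h1
  omega

theorem key_inj {σ a b i j : ℕ} (hi : i < σ) (hj : j < σ) (ha : 0 < a)
    (h : σ * a - i = σ * b - j) : i = j := by
  obtain rfl : a = b := le_antisymm (key_le hi h.le) (key_le hj h.ge)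
  have := Nat.mul_le_mul_left σ ha
  omega

/-- Chosen items of one kind, `f 0, …, f (k - 1)` in the order of decreasing keys, with rounded
positions `τ`, of which those marked by `del` are to be deleted. `len` and `th` are the
scaled lengths and the thicknesses of the `m` items. -/
structure Sched (σ m k cap : ℕ) (len th : ℕ → ℕ) (pos : ℕ → Prop) (f τ : ℕ → ℕ)
    (del : ℕ → Bool) : Prop where
  lt : ∀ a < k, f a < m
  key : ∀ a b, a < b → b < k → len (f b) - f b < len (f a) - f a
  key_start : ∀ a < k, len (f a) - f a < len m - m
  anti : ∀ a, a + 1 < k → len (f (a + 1)) ≤ len (f a)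
  pos : ∀ a ≤ k, pos (τ a)
  le : ∀ a ≤ k, τ a ≤ σ * ∑ i ∈ Finset.range a, th (f i)
  mono : ∀ a < k, τ a ≤ τ (a + 1)
  step : ∀ a < k, del a = false → τ a + σ * th (f a) ≤ τ (a + 1)
  cap : σ * ∑ i ∈ Finset.range k, th (f i) ≤ cap

theorem Sched.le_cap {σ m k cap : ℕ} {len th : ℕ → ℕ} {pos : ℕ → Prop} {f τ : ℕ → ℕ}
    {del : ℕ → Bool} (h : Sched σ m k cap len th pos f τ del) {a : ℕ} (ha : a ≤ k) :
    τ a ≤ cap :=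
  (h.le a ha).trans ((Nat.mul_le_mul_left σ (Finset.sum_le_sum_of_subset
    (Finset.range_mono ha))).trans h.cap)

theorem Sched.len_le {σ m k cap : ℕ} {len th : ℕ → ℕ} {pos : ℕ → Prop} {f τ : ℕ → ℕ}
    {del : ℕ → Bool} (h : Sched σ m k cap len th pos f τ del) {a x : ℕ} (ha : a < k)
    (hx : x ≤ a) : len (f a) ≤ len (f x) := by
  induction a with
  | zero => rw [Nat.le_zero.1 hx]
  | succ a ih =>
    rcases Nat.le_succ_iff.1 hx with hx | rfl
    · exact (h.anti a ha).trans (ih (by omega) hx)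
    · exact le_rfl

theorem Sched.sum_range_succ {σ m k cap : ℕ} {len th : ℕ → ℕ} {pos : ℕ → Prop} {f τ : ℕ → ℕ}
    {del : ℕ → Bool} (h : Sched σ m k cap len th pos f τ del) {a : ℕ} (ha : a < k)
    (F : ℕ → ℕ) :
    ∑ x ∈ Finset.range (a + 1), F (f x) = ∑ y ∈ (Finset.range (a + 1)).image f, F y := by
  have hne : ∀ x y, x < y → y < a + 1 → f x ≠ f y := fun x y hxy hy he => by
    have := h.key x y hxy (by omega)
    rw [he] at this
    exact lt_irrefl _ this
  refine (Finset.sum_image fun x hx y hy hxy => ?_).symm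
  rcases lt_trichotomy x y with hlt | heq | hlt
  · exact absurd hxy (hne x y hlt (Finset.mem_range.1 hy))
  · exact heq
  · exact absurd hxy.symm (hne y x hlt (Finset.mem_range.1 hx))

/-- The total profit of the items of a schedule from position `a` on that are not deleted. -/
def restProfit (k a : ℕ) (pr f : ℕ → ℕ) (del : ℕ → Bool) : ℕ :=
  ∑ x ∈ Finset.Ico a k, if del x then 0 else pr (f x)

theorem restProfit_succ {k a : ℕ} (pr f : ℕ → ℕ) (del : ℕ → Bool) (ha : a < k) :
    restProfit k a pr f del = (if del a then 0 else pr (f a)) + restProfit k (a + 1) pr f del :=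
  Finset.sum_eq_sum_Ico_succ_bot ha _

section Chains

variable {I : Instance} {r kH kV : ℕ} {f τ g ρ : ℕ → ℕ} {delH delV : ℕ → Bool}

/-- The scheduled horizontal items of an instance. -/
abbrev SchedH (I : Instance) (r k : ℕ) (f τ : ℕ → ℕ) (del : ℕ → Bool) : Prop :=
  Sched I.scale I.numHor k (I.scale * I.hL) I.lenH (arrayOf fun i => (I.hor i).height)
    (posH I r) f τ del

/-- The scheduled vertical items of an instance. -/
abbrev SchedV (I : Instance) (r k : ℕ) (g ρ : ℕ → ℕ) (del : ℕ → Bool) : Prop :=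
  Sched I.scale I.numVer k (I.scale * I.wL) I.lenV (arrayOf fun j => (I.ver j).width)
    (posV I r) g ρ del

/-- Some chain appends at most `d` items of total profit at least `q`. -/
def HasChain (I : Instance) (r i j t l d q : ℕ) : Prop :=
  ∃ n ≤ d, ∃ q', Chain I r i j t l n q' ∧ q ≤ q'

theorem HasChain.mono {i j t l d d' q : ℕ} (h : HasChain I r i j t l d q) (hd : d ≤ d') :
    HasChain I r i j t l d' q := by
  obtain ⟨n, hn, q', hc, hq⟩ := h
  exact ⟨n, hn.trans hd, q', hc, hq⟩

/-- Two schedules can be merged: if for every pair of a horizontal item `f a` and a vertical item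
`g b` one can be placed after the other, then one of the two next items can always be placed
without making it impossible to place the other one. -/
theorem exists_chain (hH : SchedH I r kH f τ delH) (hV : SchedV I r kV g ρ delV)
    (hpair : ∀ a < kH, ∀ b < kV,
      I.scale * (∑ i ∈ Finset.range (a + 1), arrayOf (fun i => (I.hor i).height) (f i)) +
          I.lenV (g b) ≤ I.scale * I.N ∨
        I.scale * (∑ i ∈ Finset.range (b + 1), arrayOf (fun j => (I.ver j).width) (g i)) +
          I.lenH (f a) ≤ I.scale * I.N) :
    ∀ d a b, a ≤ kH → b ≤ kV → (kH - a) + (kV - b) = d → ∀ i j t l,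
      (∀ a', a ≤ a' → a' < kH → I.lenH (f a') - f a' < I.lenH i - i) →
      (∀ b', b ≤ b' → b' < kV → I.lenV (g b') - g b' < I.lenV j - j) →
      t ≤ τ a → l ≤ ρ b →
      (a < kH → I.scale * (∑ i ∈ Finset.range b, arrayOf (fun j => (I.ver j).width) (g i)) +
        I.lenH (f a) ≤ I.scale * I.N) →
      (b < kV → I.scale * (∑ i ∈ Finset.range a, arrayOf (fun i => (I.hor i).height) (f i)) +
        I.lenV (g b) ≤ I.scale * I.N) →
      HasChain I r i j t l d
        (restProfit kH a (arrayOf fun i => (I.hor i).profit) f delH +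
          restProfit kV b (arrayOf fun j => (I.ver j).profit) g delV) := by
  intro d
  induction d with
  | zero =>
    intro a b ha hb hd i j t l _ _ _ _ _ _
    obtain rfl : a = kH := by omega
    obtain rfl : b = kV := by omega
    exact ⟨0, le_rfl, 0, Chain.nil i j t l, by simp [restProfit]⟩
  | succ d ih =>
    intro a b ha hb hd i j t l hi hj ht hl hfH hfV
    have moveH : a < kH → (b < kV →
        I.scale * (∑ i ∈ Finset.range (a + 1), arrayOf (fun i => (I.hor i).height) (f i)) +
          I.lenV (g b) ≤ I.scale * I.N) → HasChain I r i j t l (d + 1)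
        (restProfit kH a (arrayOf fun i => (I.hor i).profit) f delH +
          restProfit kV b (arrayOf fun j => (I.ver j).profit) g delV) := by
      intro haH hfV'
      have hfH' : a + 1 < kH →
          I.scale * (∑ i ∈ Finset.range b, arrayOf (fun j => (I.ver j).width) (g i)) +
            I.lenH (f (a + 1)) ≤ I.scale * I.N := fun h =>
        (Nat.add_le_add_left (hH.anti a h) _).trans (hfH haH)
      rw [restProfit_succ _ _ _ haH]
      cases hdel : delH a with
      | true =>
        simp only [if_true, zero_add]
        exact (ih (a + 1) b haH hb (by omega) i j t l (fun a' h => hi a' (by omega)) hj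
          (ht.trans (hH.mono a haH)) hl hfH' hfV').mono (by omega)
      | false =>
        obtain ⟨n, hn, q, hc, hq⟩ := ih (a + 1) b haH hb (by omega) (f a) j (τ (a + 1)) l
          (fun a' h h' => hH.key a a' h h') hj le_rfl hl hfH' hfV'
        refine ⟨n + 1, by omega, _, Chain.hor ⟨rfl, rfl, hH.lt a haH, hi a le_rfl haH, ?_,
          hH.le_cap haH, ?_⟩ (hH.pos _ haH) hc, ?_⟩
        · exact (Nat.add_le_add_right ht _).trans (hH.step a haH hdel)
        · exact (Nat.add_le_add_right (hl.trans (hV.le b hb)) _).trans (hfH haH)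
        · simp only [Bool.false_eq_true, if_false]; omega
    have moveV : b < kV → (a < kH →
        I.scale * (∑ i ∈ Finset.range (b + 1), arrayOf (fun j => (I.ver j).width) (g i)) +
          I.lenH (f a) ≤ I.scale * I.N) → HasChain I r i j t l (d + 1)
        (restProfit kH a (arrayOf fun i => (I.hor i).profit) f delH +
          restProfit kV b (arrayOf fun j => (I.ver j).profit) g delV) := by
      intro hbV hfH'
      have hfV' : b + 1 < kV →
          I.scale * (∑ i ∈ Finset.range a, arrayOf (fun i => (I.hor i).height) (f i)) +
            I.lenV (g (b + 1)) ≤ I.scale * I.N := fun h =>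
        (Nat.add_le_add_left (hV.anti b h) _).trans (hfV hbV)
      rw [restProfit_succ _ _ _ hbV]
      cases hdel : delV b with
      | true =>
        simp only [if_true, zero_add]
        exact (ih a (b + 1) ha hbV (by omega) i j t l hi (fun b' h => hj b' (by omega)) ht
          (hl.trans (hV.mono b hbV)) hfH' hfV').mono (by omega)
      | false =>
        obtain ⟨n, hn, q, hc, hq⟩ := ih a (b + 1) ha hbV (by omega) i (g b) t (ρ (b + 1))
          hi (fun b' h h' => hV.key b b' h h') ht le_rfl hfH' hfV'
        refine ⟨n + 1, by omega, _, Chain.ver ⟨rfl, rfl, hV.lt b hbV, hj b le_rfl hbV, ?_,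
          hV.le_cap hbV, ?_⟩ (hV.pos _ hbV) hc, ?_⟩
        · exact (Nat.add_le_add_right hl _).trans (hV.step b hbV hdel)
        · exact (Nat.add_le_add_right (ht.trans (hH.le a ha)) _).trans (hfV hbV)
        · simp only [Bool.false_eq_true, if_false]; omega
    by_cases haH : a < kH
    · by_cases hbV : b < kV
      · rcases hpair a haH b hbV with h | h
        · exact moveH haH fun _ => h
        · exact moveV hbV fun _ => h
      · exact moveH haH fun h => absurd h hbV
    · exact moveV (by omega) fun h => absurd h haH

end Chains

/-- Every set of items of one kind has a schedule that loses at most the fraction `1 / (r + 1)` of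
its profit, if its total thickness is at most `c`. -/
theorem exists_sched {σ m r N c : ℕ} (len w th pr : ℕ → ℕ) (A : Finset ℕ) (hm : m < σ)
    (hlen : ∀ i < m, len i = σ * w i) (hlen_m : len m = σ * N + 1 + m)
    (hA : ∀ i ∈ A, i < m ∧ 0 < w i ∧ w i ≤ N) (hc : ∑ i ∈ A, th i ≤ c) :
    ∃ (f τ : ℕ → ℕ) (del : ℕ → Bool),
      Sched σ m A.card (σ * c) len th (RPos σ th m r) f τ del ∧ (∀ a < A.card, f a ∈ A) ∧
      (r + 1) * ∑ i ∈ A, pr i ≤ (r + 1) * restProfit A.card 0 pr f del + ∑ i ∈ A, pr i := by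
  have hcard : A.card ≤ m := by
    have := Finset.card_le_card (s := A) (t := Finset.range m) fun i hi =>
      Finset.mem_range.2 (hA i hi).1
    rwa [Finset.card_range] at this
  obtain ⟨f, hfA, hfk, hfs⟩ := exists_sorted (fun i => len i - i) A fun a ha b hb h => by
    simp only [hlen a (hA a ha).1, hlen b (hA b hb).1] at h
    exact key_inj ((hA a ha).1.trans hm) ((hA b hb).1.trans hm) (hA a ha).2.1 h
  obtain ⟨del, τ, t1, t2, t3, t4, t5⟩ := exists_rounding (s := σ) (k := A.card) (r := r)
    (m := m) th (fun a => th (f a)) (fun a => pr (f a)) (by omega)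
    fun a ha => ⟨f a, (hA _ (hfA a ha)).1, rfl⟩
  rw [hfs pr, Finset.range_eq_Ico] at t5
  refine ⟨f, τ, del, ⟨fun a ha => (hA _ (hfA a ha)).1, hfk, fun a ha => ?_, fun a ha => ?_, t1,
    t2, t3, t4, ?_⟩, hfA, t5⟩
  · have h := hA _ (hfA a ha)
    rw [hlen _ h.1, hlen_m]
    have := Nat.mul_le_mul_left σ h.2.2
    omega
  · have h := hA _ (hfA a (by omega))
    have h' := hA _ (hfA (a + 1) ha)
    have hk := hfk a (a + 1) (by omega) ha
    simp only [hlen _ h.1, hlen _ h'.1] at hk ⊢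
    exact Nat.mul_le_mul_left σ (key_le (h'.1.trans hm) hk.le)
  · rw [hfs th]
    exact Nat.mul_le_mul_left σ hc

theorem sum_arrayOf {n : ℕ} (S : Finset (Fin n)) (F : Fin n → ℕ) :
    ∑ k ∈ S.map Fin.valEmbedding, arrayOf F k = ∑ i ∈ S, F i := by
  rw [Finset.sum_map]
  exact Finset.sum_congr rfl fun i _ => arrayOf_fin F i

/-- Every L-packing is approximated by a chain from the start record. -/
theorem exists_chain_of_isLPacking {I : Instance} (r : ℕ) {P : I.Placement} (hP : P.IsLPacking) :
    ∃ n ≤ I.scale, ∃ q, Chain I r I.numHor I.numVer 0 0 n q ∧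
      (r + 1) * P.profit ≤ (r + 1) * q + P.profit := by
  classical
  let SH : Finset (Fin I.numHor) := Finset.univ.filter fun i => Sum.inl i ∈ P.chosen
  let SV : Finset (Fin I.numVer) := Finset.univ.filter fun j => Sum.inr j ∈ P.chosen
  let A : Finset ℕ := SH.map Fin.valEmbedding
  let B : Finset ℕ := SV.map Fin.valEmbedding
  have hA : ∀ k ∈ A, ∃ i : Fin I.numHor, Sum.inl i ∈ P.chosen ∧ (i : ℕ) = k := by
    intro k hk
    obtain ⟨i, hi, rfl⟩ := Finset.mem_map.1 hk
    exact ⟨i, (Finset.mem_filter.1 hi).2, rfl⟩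
  have hB : ∀ k ∈ B, ∃ j : Fin I.numVer, Sum.inr j ∈ P.chosen ∧ (j : ℕ) = k := by
    intro k hk
    obtain ⟨i, hi, rfl⟩ := Finset.mem_map.1 hk
    exact ⟨i, (Finset.mem_filter.1 hi).2, rfl⟩
  have hprofit : P.profit = ∑ i ∈ A, arrayOf (fun i => (I.hor i).profit) i +
      ∑ j ∈ B, arrayOf (fun j => (I.ver j).profit) j := by
    rw [sum_arrayOf, sum_arrayOf, Finset.sum_filter, Finset.sum_filter, Placement.profit]
    have : P.chosen = Finset.univ.filter fun k => k ∈ P.chosen := by simp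
    rw [this, Finset.sum_filter, Fintype.sum_sum_type]
    simp [item]
  -- horizontal items overlap horizontally because they are wider than half of the knapsack
  have hdisH : ∀ i i' : Fin I.numHor, Sum.inl i ∈ P.chosen → Sum.inl i' ∈ P.chosen → i ≠ i' →
      P.y (Sum.inl i) + (I.hor i).height ≤ P.y (Sum.inl i') ∨
        P.y (Sum.inl i') + (I.hor i').height ≤ P.y (Sum.inl i) := by
    intro i i' hi hi' hne
    have h1 := (hP.hor_box i hi).1
    have h2 := (hP.hor_box i' hi').1
    have h3 := hP.disjoint _ hi _ hi' fun h => hne (Sum.inl_injective h)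
    simp only [Placement.right, Placement.top, item, Sum.elim_inl] at h1 h2 h3
    have := I.hor_width i
    have := I.hor_width i'
    omega
  have hdisV : ∀ j j' : Fin I.numVer, Sum.inr j ∈ P.chosen → Sum.inr j' ∈ P.chosen → j ≠ j' →
      P.x (Sum.inr j) + (I.ver j).width ≤ P.x (Sum.inr j') ∨
        P.x (Sum.inr j') + (I.ver j').width ≤ P.x (Sum.inr j) := by
    intro i i' hi hi' hne
    have h1 := (hP.ver_box i hi).2
    have h2 := (hP.ver_box i' hi').2
    have h3 := hP.disjoint _ hi _ hi' fun h => hne (Sum.inr_injective h)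
    simp only [Placement.right, Placement.top, item, Sum.elim_inr] at h1 h2 h3
    have := I.ver_height i
    have := I.ver_height i'
    omega
  -- a set of chosen items that is too thick contains an item that reaches far
  have hstackH : ∀ S ⊆ A, ∀ b, b < ∑ k ∈ S, arrayOf (fun i => (I.hor i).height) k →
      ∃ i : Fin I.numHor, (i : ℕ) ∈ S ∧ Sum.inl i ∈ P.chosen ∧ b < P.top (Sum.inl i) := by
    intro S hS b hb
    by_contra! hno
    refine absurd hb (not_lt.2 (sum_le_of_disjoint S (arrayOf fun i => P.y (Sum.inl i)) _ b ?_ ?_))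
    · intro k hk
      obtain ⟨i, hi, rfl⟩ := hA k (hS hk)
      rw [arrayOf_fin, arrayOf_fin]
      exact hno i hk hi
    · intro k hk k' hk' hne
      obtain ⟨i, hi, rfl⟩ := hA k (hS hk)
      obtain ⟨i', hi', rfl⟩ := hA k' (hS hk')
      simp only [arrayOf_fin]
      exact hdisH i i' hi hi' fun h => hne (by rw [h])
  have hstackV : ∀ S ⊆ B, ∀ b, b < ∑ k ∈ S, arrayOf (fun j => (I.ver j).width) k →
      ∃ j : Fin I.numVer, (j : ℕ) ∈ S ∧ Sum.inr j ∈ P.chosen ∧ b < P.right (Sum.inr j) := by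
    intro S hS b hb
    by_contra! hno
    refine absurd hb (not_lt.2 (sum_le_of_disjoint S (arrayOf fun i => P.x (Sum.inr i)) _ b ?_ ?_))
    · intro k hk
      obtain ⟨i, hi, rfl⟩ := hB k (hS hk)
      rw [arrayOf_fin, arrayOf_fin]
      exact hno i hk hi
    · intro k hk k' hk' hne
      obtain ⟨i, hi, rfl⟩ := hB k (hS hk)
      obtain ⟨i', hi', rfl⟩ := hB k' (hS hk')
      simp only [arrayOf_fin]
      exact hdisV i i' hi hi' fun h => hne (by rw [h])
  have hwN : ∀ i, Sum.inl i ∈ P.chosen → (I.hor i).width ≤ I.N := fun i hi => by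
    have := (hP.hor_box i hi).1
    simp only [Placement.right, item, Sum.elim_inl] at this
    omega
  have hhN : ∀ j, Sum.inr j ∈ P.chosen → (I.ver j).height ≤ I.N := fun i hi => by
    have := (hP.ver_box i hi).2
    simp only [Placement.top, item, Sum.elim_inr] at this
    omega
  obtain ⟨f, τ, delH, hsH, hfA, hpH⟩ := exists_sched (σ := I.scale) (m := I.numHor) (r := r)
    (N := I.N) (c := I.hL) I.lenH (arrayOf fun i => (I.hor i).width)
    (arrayOf fun i => (I.hor i).height) (arrayOf fun i => (I.hor i).profit) A
    (by simp only [scale, numItems]; omega)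
    (fun i hi => by rw [lenH, Function.update_of_ne hi.ne]) (Function.update_self _ _ _)
    (fun k hk => by
      obtain ⟨i, hi, rfl⟩ := hA k hk
      rw [arrayOf_fin]
      have := I.hor_width i
      exact ⟨i.2, by omega, hwN i hi⟩)
    (by
      by_contra! hlt
      obtain ⟨i, -, hi, h⟩ := hstackH A (fun _ h => h) _ hlt
      exact absurd (hP.hor_box i hi).2 (not_le.2 h))
  obtain ⟨g, ρ, delV, hsV, hgB, hpV⟩ := exists_sched (σ := I.scale) (m := I.numVer) (r := r)
    (N := I.N) (c := I.wL) I.lenV (arrayOf fun j => (I.ver j).height)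
    (arrayOf fun j => (I.ver j).width) (arrayOf fun j => (I.ver j).profit) B
    (by simp only [scale, numItems]; omega)
    (fun i hi => by rw [lenV, Function.update_of_ne hi.ne]) (Function.update_self _ _ _)
    (fun k hk => by
      obtain ⟨i, hi, rfl⟩ := hB k hk
      rw [arrayOf_fin]
      have := I.ver_height i
      exact ⟨i.2, by omega, hhN i hi⟩)
    (by
      by_contra! hlt
      obtain ⟨i, -, hi, h⟩ := hstackV B (fun _ h => h) _ hlt
      exact absurd (hP.ver_box i hi).1 (not_le.2 h))
  have hσ : 0 < I.scale := Nat.succ_pos _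
  obtain ⟨n, hn, q, hc, hq⟩ := exists_chain (I := I) (r := r) hsH hsV (by
    intro a ha b hb
    by_contra! hno
    obtain ⟨h1, h2⟩ := hno
    rw [hsH.sum_range_succ ha] at h1
    rw [hsV.sum_range_succ hb] at h2
    obtain ⟨i, hi, hia⟩ := hA _ (hfA a ha)
    obtain ⟨j, hj, hjb⟩ := hB _ (hgB b hb)
    rw [← hjb, lenV_of_lt, ← mul_add] at h1
    rw [← hia, lenH_of_lt, ← mul_add] at h2
    have h1' := Nat.lt_of_mul_lt_mul_left h1
    have h2' := Nat.lt_of_mul_lt_mul_left h2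
    obtain ⟨i', hi'S, hi', htop⟩ := hstackH ((Finset.range (a + 1)).image f) (fun k hk => by
      obtain ⟨x, hx, rfl⟩ := Finset.mem_image.1 hk
      exact hfA x (by have := Finset.mem_range.1 hx; omega)) (I.N - (I.ver j).height)
      (by have := hhN j hj; omega)
    obtain ⟨j', hj'S, hj', hright⟩ := hstackV ((Finset.range (b + 1)).image g) (fun k hk => by
      obtain ⟨x, hx, rfl⟩ := Finset.mem_image.1 hk
      exact hgB x (by have := Finset.mem_range.1 hx; omega)) (I.N - (I.hor i).width)
      (by have := hwN i hi; omega)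
    obtain ⟨x, hx, hxi⟩ := Finset.mem_image.1 hi'S
    obtain ⟨y, hy, hyj⟩ := Finset.mem_image.1 hj'S
    have l1 := hsH.len_le ha (Nat.lt_succ_iff.1 (Finset.mem_range.1 hx))
    have l2 := hsV.len_le hb (Nat.lt_succ_iff.1 (Finset.mem_range.1 hy))
    rw [hxi, ← hia, lenH_of_lt, lenH_of_lt] at l1
    rw [hyj, ← hjb, lenV_of_lt, lenV_of_lt] at l2
    have l1' := Nat.le_of_mul_le_mul_left l1 hσ
    have l2' := Nat.le_of_mul_le_mul_left l2 hσ
    have b1 := (hP.hor_box i' hi').1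
    have b2 := (hP.ver_box j' hj').2
    have hlr := hP.left_or_above i' j' hi' hj'
    simp only [Placement.right, Placement.top, item, Sum.elim_inl, Sum.elim_inr] at *
    omega) _ 0 0 (Nat.zero_le _) (Nat.zero_le _) rfl I.numHor I.numVer 0 0
    (fun a _ ha => hsH.key_start a ha) (fun b _ hb => hsV.key_start b hb) (Nat.zero_le _)
    (Nat.zero_le _)
    (fun h => by
      obtain ⟨i, hi, hia⟩ := hA _ (hfA 0 h)
      rw [← hia, lenH_of_lt]
      simpa using Nat.mul_le_mul_left I.scale (hwN i hi))
    (fun h => by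
      obtain ⟨j, hj, hjb⟩ := hB _ (hgB 0 h)
      rw [← hjb, lenV_of_lt]
      simpa using Nat.mul_le_mul_left I.scale (hhN j hj))
  refine ⟨n, hn.trans ?_, q, hc, ?_⟩
  · have h1 : A.card ≤ I.numHor := by
      rw [Finset.card_map]; exact (Finset.card_le_univ _).trans (Fintype.card_fin _).le
    have h2 : B.card ≤ I.numVer := by
      rw [Finset.card_map]; exact (Finset.card_le_univ _).trans (Fintype.card_fin _).le
    simp only [scale, numItems]
    omega
  · have := Nat.mul_le_mul_left (r + 1) hq
    rw [hprofit]
    rw [mul_add] at this ⊢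
    omega

/-- If both arms are at most half as thick as the knapsack, every packing is an L-packing, since
a vertical item can be neither to the right of a horizontal item nor below it. -/
theorem Instance.Placement.IsPacking.isLPacking {I : Instance} {P : I.Placement}
    (hP : P.IsPacking) (hw : 2 * I.wL ≤ I.N) (hh : 2 * I.hL ≤ I.N) : P.IsLPacking := by
  refine ⟨hP, fun i j hi hj => ?_⟩
  have h1 := hP.hor_box i hi
  have h2 := hP.ver_box j hj
  have h3 := hP.disjoint _ hi _ hj (by simp)
  have h4 := I.hor_width i
  have h5 := I.ver_height j
  simp only [Placement.right, Placement.top, item, Sum.elim_inl, Sum.elim_inr] at *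
  omega

end LPack

/-- There is a PTAS for the L-packing problem: one program that, for every fixed `ε > 0`, computes
in polynomial time a `(1 + ε)`-approximate L-packing. If both arms of the region have thickness at
most `N / 2`, the guarantee is relative to all packings into the two arms. -/
theorem mainTheorem2 :
    ∃ A : LPack.Prog, ∀ ε : ℚ, 0 < ε → ∃ c : ℕ, ∀ I : LPack.Instance,
      ∃ (t : ℕ) (s : LPack.State),
        LPack.Exec A (I.input ε) t s ∧
        t ≤ c * (I.numItems + 1) ^ c ∧
        (I.output s).IsLPacking ∧
        (∀ P : I.Placement, P.IsLPacking →
          (P.profit : ℚ) ≤ (1 + ε) * ((I.output s).profit : ℚ)) ∧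
        (2 * I.wL ≤ I.N → 2 * I.hL ≤ I.N → ∀ P : I.Placement, P.IsPacking →
          (P.profit : ℚ) ≤ (1 + ε) * ((I.output s).profit : ℚ)) := by
  refine ⟨LPack.scheme, fun ε hε => ?_⟩
  obtain ⟨c, hc⟩ := LPack.polyBdd_timeScheme ε.den
  refine ⟨c, fun I => ?_⟩
  obtain ⟨t, s, hexec, ht, hpack, hopt⟩ := LPack.scheme_spec I ε
  have happrox : ∀ P : I.Placement, P.IsLPacking →
      (P.profit : ℚ) ≤ (1 + ε) * ((I.output s).profit : ℚ) := by
    intro P hP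
    obtain ⟨n, hn, q, hq, hP'⟩ := LPack.exists_chain_of_isLPacking ε.den hP
    have hden : (0 : ℚ) < ε.den := by exact_mod_cast ε.den_pos
    -- `1 / den ≤ ε`, since the numerator is at least `1`
    have hε' : 1 ≤ ε * ε.den := by
      rw [Rat.mul_den_eq_num]
      exact_mod_cast Int.add_one_le_iff.2 (Rat.num_pos.2 hε)
    have h1 : ((ε.den : ℚ) + 1) * P.profit ≤ (ε.den + 1) * q + P.profit := by exact_mod_cast hP'
    have h2 : (q : ℚ) ≤ (I.output s).profit := by exact_mod_cast hopt n hn q hq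
    have h3 : (0 : ℚ) ≤ q := Nat.cast_nonneg q
    have h4 : (ε.den : ℚ) * P.profit ≤ ε.den * ((1 + ε) * q) := by nlinarith
    exact (le_of_mul_le_mul_left h4 hden).trans
      (mul_le_mul_of_nonneg_left h2 (by linarith))
  refine ⟨t, s, hexec, ht.trans ((LPack.timeScheme_mono (Nat.le_add_right _ _)
    (Nat.le_add_left _ _)).trans (hc I.numItems)), hpack, happrox, fun hw hh P hP =>
    happrox P (hP.isLPacking hw hh)⟩
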